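/- All graphs are finite and simple. For a graph $G$ let $\lambda_1(G)$ denote the largest eigenvalue of its adjacency matrix. A connected subcubic bipartite graph is a connected bipartite graph with maximum degree exactly $3$ that is not regular; in such a graph a vertex of degree less than $3$ is called unsaturated. For $n\ge 6$ define graphs $B_n$ on $n$ vertices recursively: $B_6$ is obtained from $K_{3,3}$ by deleting an edge; if $n\ge 7$ is odd, $B_n$ is obtained from $B_{n-1}$ by adding a new vertex and joining it to one of the unsaturated vertices of $B_{n-1}$; if $n\ge 8$ is even, $B_n$ is obtained from $B_{n-1}$ by adding a new vertex and joining it to all unsaturated vertices of $B_{n-1}$. Theorem. Let $n\ge 6$. The graph $B_n$ exists and is a connected subcubic bipartite graph (whichever unsaturated vertices are used at the odd steps), and for every connected subcubic bipartite graph $G$ on $n$ vertices, $$\lambda_1(G)\le \lambda_1(B_n),$$ with equality if and only if $G\cong B_n$. (In particular $B_n$ does not depend, up to isomorphism, on the choices made in its construction.) -/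

import Mathlib

open Classical in
/-- `λ₁(G)`: the largest eigenvalue of the real adjacency matrix of the finite graph `G`
(for a nonempty vertex set the eigenvalues form a nonempty finite set of reals). -/
noncomputable def lambdaOne {V : Type*} [Fintype V] (G : SimpleGraph V) : ℝ :=
  sSup {μ : ℝ | Module.End.HasEigenvalue (Matrix.toLin' (G.adjMatrix ℝ)) μ}

open Classical in
/-- `G` is a connected irregular (that is, not regular) bipartite graph with maximum
degree `Δ`. -/
structure IsConnectedIrregularBipartite {V : Type*} [Fintype V] (Δ : ℕ)
    (G : SimpleGraph V) : Prop where
  connected : G.Connected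
  bipartite : G.IsBipartite
  irregular : ¬ ∃ d : ℕ, G.IsRegularOfDegree d
  maxDegree_eq : G.maxDegree = Δ

/-- `G` is a connected subcubic bipartite graph: connected, bipartite, irregular and of maximum
degree `3`. -/
abbrev IsConnectedSubcubicBipartite {V : Type*} [Fintype V] (G : SimpleGraph V) : Prop :=
  IsConnectedIrregularBipartite 3 G

open Classical in
/-- The set of unsaturated vertices: those of degree less than `3`. -/
def unsaturated {V : Type*} [Fintype V] (G : SimpleGraph V) : Set V :=
  {v | G.degree v < 3}

/-- The graph obtained from `G` by adding one new vertex `Fin.last m` and joining it to exactly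
the vertices in `S`. -/
def addVertex {m : ℕ} (G : SimpleGraph (Fin m)) (S : Set (Fin m)) :
    SimpleGraph (Fin (m + 1)) :=
  G.map Fin.castSucc ⊔
    SimpleGraph.fromRel (fun x y => y = Fin.last m ∧ ∃ s ∈ S, x = s.castSucc)

/-- `IsB n B`: the graph `B` on `n` vertices arises by the recursive construction of `B_n`.
The construction leaves a choice (which unsaturated vertex is used at an odd step); every
outcome of every choice is allowed. -/
inductive IsB : (n : ℕ) → SimpleGraph (Fin n) → Prop
  /-- `B_6` is `K_{3,3}` with one edge deleted. -/
  | base (B : SimpleGraph (Fin 6))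
      (h : Nonempty (B ≃g (completeBipartiteGraph (Fin 3) (Fin 3)).deleteEdges
        {s(Sum.inl 0, Sum.inr 0)})) :
      IsB 6 B
  /-- For odd `m + 1 ≥ 7`, the new vertex is joined to one unsaturated vertex. -/
  | odd_step (m : ℕ) (B : SimpleGraph (Fin m)) (hB : IsB m B) (hm : Odd (m + 1))
      (v : Fin m) (hv : v ∈ unsaturated B) :
      IsB (m + 1) (addVertex B {v})
  /-- For even `m + 1 ≥ 8`, the new vertex is joined to all unsaturated vertices. -/
  | even_step (m : ℕ) (B : SimpleGraph (Fin m)) (hB : IsB m B) (hm : Even (m + 1)) :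
      IsB (m + 1) (addVertex B (unsaturated B))

/-! Sort the vertices of `G` by a positive eigenvector `x` for the largest eigenvalue, in decreasing
order. Two summations by parts show that the quadratic form of a matrix at a decreasing nonnegative
vector is a combination, with nonnegative coefficients, of the sums over its leading `k × l` blocks.
So it suffices to find a copy of `B_n` on the same vertices all of whose leading block sums are at
least those of `G`; Rayleigh's principle then gives the inequality.

Block sums of `G` are bounded by degree, parity and the bipartition: `3k` in general, `3k - 2` (`k`
even) or `3k - 3` (`k` odd) for a square block, and `3k - 1` for a `k × (k+1)` block. `B_n`, viewed
as a ladder growing out of `K_{3,3}` minus an edge, attains these bounds once `k ≥ 5`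
(`blockSum_ladderMatrix_self`, `blockSum_ladderMatrix_succ`). For smaller blocks the best
arrangement depends on how the first five vertices of `G` are split between the two sides, so the
ladder is relabelled there by a permutation `τ`; this is a finite check (`blockSum_le_placement`).

If the eigenvalues agree, the relabelled vector is an eigenvector of the ladder. Its entries drop
strictly between consecutive rungs (`ladder_eigenvector_strict`), and at every strict drop the block
sums must coincide (`blockSum_eq_of_mulVec_eq`). Hence the row sums over the first `l` columns agree
for even `l ≥ 4`, which is enough to read off the recursive construction
(`isB_matrixGraph_of_sum_eq`). What remains free is the attachment at odd steps, and the flip of the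
ladder shows that this choice does not matter. -/

/-! ### Upper bounds for the leading block sums of a subcubic matrix. -/

/-- The sum of the entries of `a` in the first `k` rows and first `l` columns. -/
def blockSum (a : ℕ → ℕ → ℕ) (k l : ℕ) : ℕ :=
  ∑ i ∈ Finset.range k, ∑ j ∈ Finset.range l, a i j

/-- A `0/1` matrix with the properties of the adjacency matrix of a connected irregular bipartite
graph on `{0, …, n - 1}` with degrees at most `3` and with sides given by `s`. -/
structure IsSubcubicMatrix (n : ℕ) (s : ℕ → Bool) (a : ℕ → ℕ → ℕ) : Prop where
  le_one : ∀ i j, a i j ≤ 1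
  symm : ∀ i j, a i j = a j i
  bipartite : ∀ i j, s i = s j → a i j = 0
  row_le : ∀ i l, ∑ j ∈ Finset.range l, a i j ≤ 3
  not_closed : ∀ k, 1 ≤ k → k ≤ n → blockSum a k k ≠ 3 * k

lemma blockSum_comm {a : ℕ → ℕ → ℕ} (h : ∀ i j, a i j = a j i) (k l : ℕ) :
    blockSum a k l = blockSum a l k := by
  unfold blockSum
  rw [Finset.sum_comm]
  exact Finset.sum_congr rfl fun i _ => Finset.sum_congr rfl fun j _ => h _ _

lemma blockSum_succ_left (a : ℕ → ℕ → ℕ) (k l : ℕ) :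
    blockSum a (k + 1) l = blockSum a k l + ∑ j ∈ Finset.range l, a k j :=
  Finset.sum_range_succ _ _

lemma blockSum_succ_right {a : ℕ → ℕ → ℕ} (h : ∀ i j, a i j = a j i) (k l : ℕ) :
    blockSum a k (l + 1) = blockSum a k l + ∑ j ∈ Finset.range k, a l j := by
  rw [blockSum_comm h, blockSum_succ_left, blockSum_comm h]

namespace IsSubcubicMatrix

variable {n : ℕ} {s : ℕ → Bool} {a : ℕ → ℕ → ℕ}

lemma diag_eq_zero (h : IsSubcubicMatrix n s a) (i : ℕ) : a i i = 0 := h.bipartite i i rfl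

lemma blockSum_le (h : IsSubcubicMatrix n s a) (k l : ℕ) : blockSum a k l ≤ 3 * k := by
  unfold blockSum
  refine (Finset.sum_le_sum fun i _ => h.row_le i l).trans ?_
  simp [mul_comm]

/-- The block sum is `2e`, with `e` the number of edges among the first `k` vertices. For even `k`
the number `3k - 2e` is even and nonzero. For odd `k` the smaller side has at most `(k - 1) / 2`
vertices and meets every edge, so `2e ≤ 3k - 3`. -/
lemma blockSum_self_le (h : IsSubcubicMatrix n s a) {k : ℕ} (hk : 1 ≤ k) (hkn : k ≤ n) :
    blockSum a k k + 2 + k % 2 ≤ 3 * k := by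
  classical
  set R := Finset.range k
  set X := R.filter fun i => s i = true
  set Y := R.filter fun i => ¬ s i = true
  have hXY : X.card + Y.card = k := by
    rw [Finset.card_filter_add_card_filter_not, Finset.card_range]
  have hsum : blockSum a k k = ∑ i ∈ X, ∑ j ∈ R, a i j + ∑ i ∈ Y, ∑ j ∈ R, a i j :=
    (Finset.sum_filter_add_sum_filter_not R (fun i => s i = true) _).symm
  have hX : ∑ i ∈ X, ∑ j ∈ R, a i j ≤ 3 * X.card :=
    (Finset.sum_le_sum fun i _ => h.row_le i k).trans (by simp [mul_comm])
  have hY : ∑ i ∈ Y, ∑ j ∈ R, a i j ≤ 3 * Y.card :=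
    (Finset.sum_le_sum fun i _ => h.row_le i k).trans (by simp [mul_comm])
  have hX' : ∑ i ∈ X, ∑ j ∈ R, a i j = ∑ i ∈ X, ∑ j ∈ Y, a i j := by
    refine Finset.sum_congr rfl fun i hi => (Finset.sum_subset (Finset.filter_subset _ _) ?_).symm
    intro j hj hjY
    refine h.bipartite i j ?_
    simp only [X, Finset.mem_filter] at hi hjY
    grind
  have hY' : ∑ i ∈ Y, ∑ j ∈ R, a i j = ∑ i ∈ Y, ∑ j ∈ X, a i j := by
    refine Finset.sum_congr rfl fun i hi => (Finset.sum_subset (Finset.filter_subset _ _) ?_).symm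
    intro j hj hjY
    refine h.bipartite i j ?_
    simp only [Y, Finset.mem_filter] at hi hjY
    grind
  have hE : ∑ i ∈ X, ∑ j ∈ R, a i j = ∑ i ∈ Y, ∑ j ∈ R, a i j := by
    rw [hX', hY', Finset.sum_comm]
    exact Finset.sum_congr rfl fun i _ => Finset.sum_congr rfl fun j _ => h.symm _ _
  have := h.not_closed k hk hkn
  omega

/-- If the value were `3k`, the next vertex would have to absorb the at least two missing edge ends
of the first `k`, and the square block of size `k + 1` would then miss at most one, contrary to
`blockSum_self_le`. -/
lemma blockSum_succ_le (h : IsSubcubicMatrix n s a) {k : ℕ} (hk : 1 ≤ k) (hkn : k + 1 ≤ n) :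
    blockSum a k (k + 1) + 1 ≤ 3 * k := by
  have h1 := h.blockSum_self_le hk (by omega)
  have h2 := h.blockSum_self_le (k := k + 1) (by omega) hkn
  have h3 := h.blockSum_le k (k + 1)
  rw [blockSum_succ_left, Finset.sum_range_succ, h.diag_eq_zero] at h2
  rw [blockSum_succ_right h.symm] at *
  omega

end IsSubcubicMatrix

/-! ### The infinite ladder and its block sums. -/

/-- The three neighbours of `i` in the infinite graph whose restriction to `{0, …, n - 1}` is
the graph `B_n`. -/
def ladderNbr (i : ℕ) : Fin 3 → ℕ :=
  -- The vertices below 6 carry `K_{3,3}` without the edge between 4 and 5, with sides `{0, 1, 5}`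
  -- and `{2, 3, 4}`. From 4 and 5 start two rails, through the even and through the odd numbers,
  -- joined by the rungs `{2t, 2t + 1}` for `t ≥ 3`.
  match i with
  | 0 => ![2, 3, 4]
  | 1 => ![2, 3, 4]
  | 2 => ![0, 1, 5]
  | 3 => ![0, 1, 5]
  | 4 => ![0, 1, 6]
  | 5 => ![2, 3, 7]
  | i + 6 => ![i + 4, if i % 2 = 0 then i + 7 else i + 5, i + 8]

/-- The adjacency matrix of the infinite graph given by `ladderNbr`. -/
def ladderMatrix (i j : ℕ) : ℕ :=
  (if ladderNbr i 0 = j then 1 else 0) + (if ladderNbr i 1 = j then 1 else 0) +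
    (if ladderNbr i 2 = j then 1 else 0)

lemma ladderMatrix_symm (i j : ℕ) : ladderMatrix i j = ladderMatrix j i := by
  unfold ladderMatrix
  rcases i with _ | _ | _ | _ | _ | _ | i <;> rcases j with _ | _ | _ | _ | _ | _ | j <;>
    simp [ladderNbr] <;> split_ifs <;> omega

lemma sum_ladderMatrix_mul {R : Type*} [Semiring R] (i l : ℕ) (y : ℕ → R) :
    ∑ j ∈ Finset.range l, (ladderMatrix i j : R) * y j =
      (if ladderNbr i 0 < l then y (ladderNbr i 0) else 0) +
        (if ladderNbr i 1 < l then y (ladderNbr i 1) else 0) +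
        (if ladderNbr i 2 < l then y (ladderNbr i 2) else 0) := by
  simp [ladderMatrix, add_mul, Finset.sum_add_distrib, ite_mul]

lemma sum_ladderMatrix (i l : ℕ) :
    ∑ j ∈ Finset.range l, ladderMatrix i j =
      (if ladderNbr i 0 < l then 1 else 0) + (if ladderNbr i 1 < l then 1 else 0) +
        (if ladderNbr i 2 < l then 1 else 0) := by
  simpa using sum_ladderMatrix_mul i l (fun _ => (1 : ℕ))

lemma sum_ladderMatrix_eq_three {i l : ℕ} (h : i + 3 ≤ l) (hl : 6 ≤ l) :
    ∑ j ∈ Finset.range l, ladderMatrix i j = 3 := by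
  rw [sum_ladderMatrix]
  rcases i with _ | _ | _ | _ | _ | _ | i <;> simp [ladderNbr] <;> grind

lemma sum_ladderMatrix_add_two {i : ℕ} (hi : 4 ≤ i) :
    ∑ j ∈ Finset.range (i + 2), ladderMatrix i j = 2 := by
  rw [sum_ladderMatrix]
  rcases i with _ | _ | _ | _ | _ | _ | i <;> simp [ladderNbr] at *; split_ifs <;> omega

lemma sum_ladderMatrix_add_one {i : ℕ} (hi : 5 ≤ i) :
    ∑ j ∈ Finset.range (i + 1), ladderMatrix i j = 1 + i % 2 := by
  rw [sum_ladderMatrix]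
  rcases i with _ | _ | _ | _ | _ | _ | i <;> simp [ladderNbr] at *; split_ifs <;> omega

lemma blockSum_ladderMatrix_of_add_two_le {k l : ℕ} (h : k + 2 ≤ l) (hl : 6 ≤ l) :
    blockSum ladderMatrix k l = 3 * k := by
  unfold blockSum
  rw [Finset.sum_congr rfl fun i hi => sum_ladderMatrix_eq_three (i := i) (l := l)
    (by have := Finset.mem_range.1 hi; omega) hl]
  simp [mul_comm]

lemma blockSum_ladderMatrix_succ {k : ℕ} (hk : 5 ≤ k) :
    blockSum ladderMatrix k (k + 1) + 1 = 3 * k := by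
  obtain ⟨k, rfl⟩ : ∃ m, k = m + 1 := ⟨k - 1, by omega⟩
  rw [blockSum_succ_left, blockSum_ladderMatrix_of_add_two_le (by omega) (by omega),
    sum_ladderMatrix_add_two (by omega)]
  omega

/-- Equality in `IsSubcubicMatrix.blockSum_self_le`: from five rows on, the ladder is extremal for
square blocks. -/
lemma blockSum_ladderMatrix_self {k : ℕ} (hk : 5 ≤ k) :
    blockSum ladderMatrix k k + 2 + k % 2 = 3 * k := by
  rcases hk.eq_or_lt with rfl | hk
  · decide
  obtain ⟨k, rfl⟩ : ∃ m, k = m + 2 := ⟨k - 2, by omega⟩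
  rw [blockSum_succ_left, blockSum_succ_left,
    blockSum_ladderMatrix_of_add_two_le (by omega) (by omega), sum_ladderMatrix_add_two (by omega),
    sum_ladderMatrix_add_one (by omega)]
  omega

/-! ### The ladder, relabelled on its first five vertices, dominates every block sum. -/

/-- A permutation of `{0, …, 4}`, depending on a bipartition of this set, that moves the three
smallest elements of the majority side to `2, 3, 4` in increasing order. The arguments tell which
of `1, 2, 3, 4` are on the same side as `0`. -/
def placement : Bool → Bool → Bool → Bool → Equiv.Perm ℕ
  | true, true, _, _ => [0, 2, 4, 1, 3].formPerm
  | true, false, true, _ => [0, 2].formPerm * [1, 3, 4].formPerm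
  | true, false, false, true => [0, 2].formPerm * [1, 3].formPerm
  | true, false, false, false => 1
  | false, true, true, _ => [0, 2, 3, 4, 1].formPerm
  | false, true, false, true => [0, 2, 3, 1].formPerm
  | false, true, false, false => [1, 2].formPerm
  | false, false, true, true => [0, 2, 1].formPerm
  | false, false, true, false => [1, 2, 3].formPerm
  | false, false, false, _ => [1, 2, 3, 4].formPerm

lemma placement_apply_of_five_le (b₁ b₂ b₃ b₄ : Bool) {i : ℕ} (hi : 5 ≤ i) :
    placement b₁ b₂ b₃ b₄ i = i := by
  have key : ∀ l : List ℕ, (∀ j ∈ l, j < 5) → l.formPerm i = i := fun l hl =>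
    List.formPerm_apply_of_notMem fun hmem => by have := hl i hmem; omega
  unfold placement
  split <;> (try simp only [Equiv.Perm.mul_apply, Equiv.Perm.one_apply]) <;>
    repeat rw [key _ (by decide)]

/-- The matrix of the ladder graph with its vertices renamed by `τ`. -/
def ladderPerm (τ : Equiv.Perm ℕ) (i j : ℕ) : ℕ := ladderMatrix (τ i) (τ j)

lemma ladderPerm_symm (τ : Equiv.Perm ℕ) (i j : ℕ) : ladderPerm τ i j = ladderPerm τ j i :=
  ladderMatrix_symm _ _

lemma perm_lt {τ : Equiv.Perm ℕ} {c : ℕ} (hτ : ∀ i, c ≤ i → τ i = i) {i : ℕ} (hi : i < c) :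
    τ i < c := by
  by_contra hc
  have := τ.injective (hτ (τ i) (by omega))
  omega

lemma sum_range_comp_perm {M : Type*} [AddCommMonoid M] {τ : Equiv.Perm ℕ} {c : ℕ}
    (hτ : ∀ i, c ≤ i → τ i = i) {l : ℕ} (hl : c ≤ l) (f : ℕ → M) :
    ∑ j ∈ Finset.range l, f (τ j) = ∑ j ∈ Finset.range l, f j := by
  refine Finset.sum_equiv τ (fun i => ?_) fun _ _ => rfl
  simp only [Finset.mem_range]
  rcases lt_or_ge i c with hi | hi
  · have := perm_lt hτ hi
    omega
  · rw [hτ i hi]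

lemma sum_ladderPerm {τ : Equiv.Perm ℕ} {c : ℕ} (hτ : ∀ i, c ≤ i → τ i = i) (i : ℕ) {l : ℕ}
    (hl : c ≤ l) :
    ∑ j ∈ Finset.range l, ladderPerm τ i j = ∑ j ∈ Finset.range l, ladderMatrix (τ i) j :=
  sum_range_comp_perm hτ hl (ladderMatrix (τ i))

lemma blockSum_ladderPerm {τ : Equiv.Perm ℕ} (hτ : ∀ i, 5 ≤ i → τ i = i) {k l : ℕ}
    (hk : 5 ≤ k) (hl : 5 ≤ l) : blockSum (ladderPerm τ) k l = blockSum ladderMatrix k l := by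
  unfold blockSum
  rw [← sum_range_comp_perm hτ hk (fun i => ∑ j ∈ Finset.range l, ladderMatrix i j)]
  exact Finset.sum_congr rfl fun i _ => sum_ladderPerm hτ i hl

lemma blockSum_ladderPerm_of_seven_le {τ : Equiv.Perm ℕ} (hτ : ∀ i, 5 ≤ i → τ i = i) {k l : ℕ}
    (hk : k ≤ 4) (hl : 7 ≤ l) : blockSum (ladderPerm τ) k l = 3 * k := by
  unfold blockSum
  have : ∀ i ∈ Finset.range k, ∑ j ∈ Finset.range l, ladderPerm τ i j = 3 := fun i hi => by
    have := perm_lt hτ (i := i) (by have := Finset.mem_range.1 hi; omega)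
    rw [sum_ladderPerm hτ i (by omega), sum_ladderMatrix_eq_three (by omega) (by omega)]
  rw [Finset.sum_congr rfl this]
  simp [mul_comm]

namespace IsSubcubicMatrix

variable {n : ℕ} {s : ℕ → Bool} {a : ℕ → ℕ → ℕ}

set_option maxHeartbeats 4000000 in
-- A finite check over the sixteen ways to split the vertices 1, 2, 3, 4 relative to 0. Individual
-- entries are used only among the first five vertices; the column of vertex 5 is controlled by the
-- row bounds and by the bound 16 on the sum of the `6 × 6` block.
lemma blockSum_le_placement (h : IsSubcubicMatrix n s a) (hn : 6 ≤ n) (hs : s 0 = true) {k l : ℕ}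
    (hk : k ≤ 4) (hkl : k ≤ l) (hl : l ≤ 6) :
    blockSum a k l ≤ blockSum (ladderPerm (placement (s 1) (s 2) (s 3) (s 4))) k l := by
  have hd := h.diag_eq_zero
  have h6 := h.blockSum_self_le (k := 6) (by omega) hn
  have r0 := h.row_le 0 6
  have r1 := h.row_le 1 6
  have r2 := h.row_le 2 6
  have r3 := h.row_le 3 6
  have r4 := h.row_le 4 6
  have s01 := h.symm 1 0
  have s02 := h.symm 2 0
  have s03 := h.symm 3 0
  have s04 := h.symm 4 0
  have s05 := h.symm 5 0
  have s12 := h.symm 2 1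
  have s13 := h.symm 3 1
  have s14 := h.symm 4 1
  have s15 := h.symm 5 1
  have s23 := h.symm 3 2
  have s24 := h.symm 4 2
  have s25 := h.symm 5 2
  have s34 := h.symm 4 3
  have s35 := h.symm 5 3
  have s45 := h.symm 5 4
  simp only [blockSum, Finset.sum_range_succ, Finset.sum_range_zero, zero_add, hd,
    s01, s02, s03, s04, s05, s12, s13, s14, s15, s23, s24, s25, s34, s35, s45]
    at h6 r0 r1 r2 r3 r4
  have o01 := h.le_one 0 1
  have o02 := h.le_one 0 2
  have o03 := h.le_one 0 3
  have o04 := h.le_one 0 4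
  have o12 := h.le_one 1 2
  have o13 := h.le_one 1 3
  have o14 := h.le_one 1 4
  have o23 := h.le_one 2 3
  have o24 := h.le_one 2 4
  have o34 := h.le_one 3 4
  have z01 := h.bipartite 0 1
  have z02 := h.bipartite 0 2
  have z03 := h.bipartite 0 3
  have z04 := h.bipartite 0 4
  have z12 := h.bipartite 1 2
  have z13 := h.bipartite 1 3
  have z14 := h.bipartite 1 4
  have z23 := h.bipartite 2 3
  have z24 := h.bipartite 2 4
  have z34 := h.bipartite 3 4
  rw [hs] at z01 z02 z03 z04
  generalize hP : ladderPerm (placement (s 1) (s 2) (s 3) (s 4)) = P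
  have hPs : ∀ i j, P i j = P j i := by subst hP; exact ladderPerm_symm _
  have t01 := hPs 1 0
  have t02 := hPs 2 0
  have t03 := hPs 3 0
  have t12 := hPs 2 1
  have t13 := hPs 3 1
  have t23 := hPs 3 2
  clear hPs
  -- With the sides fixed, the entries of `P` are known numerals and every instance is linear
  -- arithmetic in the entries of `a`.
  generalize s 1 = b1, s 2 = b2, s 3 = b3, s 4 = b4 at *
  cases b1 <;> cases b2 <;> cases b3 <;> cases b4 <;>
  simp only [reduceCtorEq, forall_const, IsEmpty.forall_iff]
    at z01 z02 z03 z04 z12 z13 z14 z23 z24 z34 <;>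
  (
    have d00 : P 0 0 = 0 := by subst hP; decide
    have d11 : P 1 1 = 0 := by subst hP; decide
    have d22 : P 2 2 = 0 := by subst hP; decide
    have d33 : P 3 3 = 0 := by subst hP; decide
    first
    | have e01 : P 0 1 = 0 := by subst hP; decide
    | have e01 : P 0 1 = 1 := by subst hP; decide
    first
    | have e02 : P 0 2 = 0 := by subst hP; decide
    | have e02 : P 0 2 = 1 := by subst hP; decide
    first
    | have e03 : P 0 3 = 0 := by subst hP; decide
    | have e03 : P 0 3 = 1 := by subst hP; decide
    first
    | have e04 : P 0 4 = 0 := by subst hP; decide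
    | have e04 : P 0 4 = 1 := by subst hP; decide
    first
    | have e05 : P 0 5 = 0 := by subst hP; decide
    | have e05 : P 0 5 = 1 := by subst hP; decide
    first
    | have e12 : P 1 2 = 0 := by subst hP; decide
    | have e12 : P 1 2 = 1 := by subst hP; decide
    first
    | have e13 : P 1 3 = 0 := by subst hP; decide
    | have e13 : P 1 3 = 1 := by subst hP; decide
    first
    | have e14 : P 1 4 = 0 := by subst hP; decide
    | have e14 : P 1 4 = 1 := by subst hP; decide
    first
    | have e15 : P 1 5 = 0 := by subst hP; decide
    | have e15 : P 1 5 = 1 := by subst hP; decide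
    first
    | have e23 : P 2 3 = 0 := by subst hP; decide
    | have e23 : P 2 3 = 1 := by subst hP; decide
    first
    | have e24 : P 2 4 = 0 := by subst hP; decide
    | have e24 : P 2 4 = 1 := by subst hP; decide
    first
    | have e25 : P 2 5 = 0 := by subst hP; decide
    | have e25 : P 2 5 = 1 := by subst hP; decide
    first
    | have e34 : P 3 4 = 0 := by subst hP; decide
    | have e34 : P 3 4 = 1 := by subst hP; decide
    first
    | have e35 : P 3 5 = 0 := by subst hP; decide
    | have e35 : P 3 5 = 1 := by subst hP; decide
    interval_cases k <;> interval_cases l <;>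
    simp only [blockSum, Finset.sum_range_succ, Finset.sum_range_zero, zero_add, add_zero, hd,
      s01, s02, s03, s12, s13, s23, t01, t02, t03, t12, t13, t23, e01, e02, e03, e04, e05, e12,
      e13, e14, e15, e23, e24, e25, e34, e35, d00, d11, d22, d33] <;> omega)

lemma blockSum_le_ladderPerm (h : IsSubcubicMatrix n s a) (hn : 6 ≤ n) (hs : s 0 = true)
    {k l : ℕ} (hk : k ≤ n) (hl : l ≤ n) :
    blockSum a k l ≤ blockSum (ladderPerm (placement (s 1) (s 2) (s 3) (s 4))) k l := by
  have hτ : ∀ i, 5 ≤ i → placement (s 1) (s 2) (s 3) (s 4) i = i :=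
    fun i hi => placement_apply_of_five_le _ _ _ _ hi
  wlog hkl : k ≤ l generalizing k l
  · rw [blockSum_comm h.symm, blockSum_comm (ladderPerm_symm _)]
    exact this hl hk (by omega)
  rcases le_or_gt k 4 with hk4 | hk4
  · rcases le_or_gt l 6 with hl6 | hl6
    · exact h.blockSum_le_placement hn hs hk4 hkl hl6
    · rw [blockSum_ladderPerm_of_seven_le hτ hk4 hl6]
      exact h.blockSum_le k l
  · rw [blockSum_ladderPerm hτ (by omega) (by omega)]
    obtain rfl | rfl | hlt : l = k ∨ l = k + 1 ∨ k + 2 ≤ l := by omega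
    · have h1 := blockSum_ladderMatrix_self (k := l) (by omega)
      have h2 := h.blockSum_self_le (k := l) (by omega) hk
      omega
    · have h1 := blockSum_ladderMatrix_succ (k := k) (by omega)
      have h2 := h.blockSum_succ_le (k := k) (by omega) hl
      omega
    · rw [blockSum_ladderMatrix_of_add_two_le hlt (by omega)]
      exact h.blockSum_le k l

end IsSubcubicMatrix

/-! ### From block sums to quadratic forms. -/

/-- Summation by parts against a sequence that vanishes at `n`. -/
lemma sum_mul_eq_sum_partialSums (u x : ℕ → ℝ) (n : ℕ) :
    ∑ j ∈ Finset.range n, u j * x j =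
      ∑ l ∈ Finset.range n, (∑ j ∈ Finset.range (l + 1), u j) * (x l - x (l + 1)) +
        (∑ j ∈ Finset.range n, u j) * x n := by
  induction n with
  | zero => simp
  | succ n ih => rw [Finset.sum_range_succ, ih, Finset.sum_range_succ _ n,
      Finset.sum_range_succ u n]; ring

lemma sum_mul_nonneg_of_partialSums_nonneg {u x : ℕ → ℝ} {n : ℕ} (hx : ∀ l < n, x (l + 1) ≤ x l)
    (hxn : x n = 0) (hu : ∀ l < n, 0 ≤ ∑ j ∈ Finset.range (l + 1), u j) :
    0 ≤ ∑ j ∈ Finset.range n, u j * x j := by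
  rw [sum_mul_eq_sum_partialSums, hxn, mul_zero, add_zero]
  exact Finset.sum_nonneg fun l hl => mul_nonneg (hu l (Finset.mem_range.1 hl))
    (sub_nonneg.2 (hx l (Finset.mem_range.1 hl)))

lemma partialSum_eq_zero_of_sum_mul_eq_zero {u x : ℕ → ℝ} {n : ℕ}
    (hx : ∀ l < n, x (l + 1) ≤ x l) (hxn : x n = 0)
    (hu : ∀ l < n, 0 ≤ ∑ j ∈ Finset.range (l + 1), u j)
    (h0 : ∑ j ∈ Finset.range n, u j * x j = 0) {l : ℕ} (hl : l < n) (hlt : x (l + 1) < x l) :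
    ∑ j ∈ Finset.range (l + 1), u j = 0 := by
  rw [sum_mul_eq_sum_partialSums, hxn, mul_zero, add_zero, Finset.sum_eq_zero_iff_of_nonneg
    fun l hl => mul_nonneg (hu l (Finset.mem_range.1 hl))
      (sub_nonneg.2 (hx l (Finset.mem_range.1 hl)))] at h0
  have := h0 l (Finset.mem_range.2 hl)
  rcases mul_eq_zero.1 this with h | h
  · exact h
  · linarith

lemma blockSum_cast_sub (a b : ℕ → ℕ → ℕ) (k l : ℕ) :
    ∑ j ∈ Finset.range l, ∑ i ∈ Finset.range k, ((b i j : ℝ) - a i j) =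
      (blockSum b k l : ℝ) - blockSum a k l := by
  rw [Finset.sum_comm]
  simp [blockSum, Finset.sum_sub_distrib]

/-- Summation by parts in the row index and then in the column index turns the difference of the two
forms into nonnegative block differences weighted by products of consecutive drops of `x`. -/
lemma quadratic_form_le_of_blockSum_le {a b : ℕ → ℕ → ℕ} {x : ℕ → ℝ} {n : ℕ}
    (hx : ∀ l < n, x (l + 1) ≤ x l) (hxn : x n = 0)
    (hab : ∀ k l, k ≤ n → l ≤ n → blockSum a k l ≤ blockSum b k l) :
    ∑ i ∈ Finset.range n, (∑ j ∈ Finset.range n, (a i j : ℝ) * x j) * x i ≤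
      ∑ i ∈ Finset.range n, (∑ j ∈ Finset.range n, (b i j : ℝ) * x j) * x i := by
  rw [← sub_nonneg, ← Finset.sum_sub_distrib]
  simp_rw [← sub_mul, ← Finset.sum_sub_distrib, ← sub_mul]
  refine sum_mul_nonneg_of_partialSums_nonneg hx hxn fun k hk => ?_
  rw [Finset.sum_comm]
  simp_rw [← Finset.sum_mul]
  refine sum_mul_nonneg_of_partialSums_nonneg hx hxn fun l hl => ?_
  rw [blockSum_cast_sub, sub_nonneg]
  exact_mod_cast hab _ _ (by omega) (by omega)

/-- A single summation by parts suffices here. The column sums of the first `k` rows of `b - a` are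
orthogonal to `x` and have nonnegative partial sums, so a partial sum vanishes wherever `x` drops
strictly. -/
lemma blockSum_eq_of_mulVec_eq {a b : ℕ → ℕ → ℕ} {x : ℕ → ℝ} {n : ℕ}
    (hx : ∀ l < n, x (l + 1) ≤ x l) (hxn : x n = 0)
    (hab : ∀ k l, k ≤ n → l ≤ n → blockSum a k l ≤ blockSum b k l)
    (heq : ∀ i < n, ∑ j ∈ Finset.range n, (a i j : ℝ) * x j =
      ∑ j ∈ Finset.range n, (b i j : ℝ) * x j) {k l : ℕ} (hk : k ≤ n) (hl : l < n)
    (hlt : x (l + 1) < x l) : blockSum a k (l + 1) = blockSum b k (l + 1) := by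
  have h0 : ∑ j ∈ Finset.range n, (∑ i ∈ Finset.range k, ((b i j : ℝ) - a i j)) * x j = 0 := by
    simp_rw [Finset.sum_mul]
    rw [Finset.sum_comm]
    refine Finset.sum_eq_zero fun i hi => ?_
    simp_rw [sub_mul]
    rw [Finset.sum_sub_distrib, heq i (by have := Finset.mem_range.1 hi; omega), sub_self]
  have := partialSum_eq_zero_of_sum_mul_eq_zero hx hxn (fun l hl => ?_) h0 hl hlt
  · rw [blockSum_cast_sub, sub_eq_zero] at this
    exact_mod_cast this.symm
  · rw [blockSum_cast_sub, sub_nonneg]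
    exact_mod_cast hab _ _ hk (by omega)

lemma sum_row_eq_of_blockSum_eq {a b : ℕ → ℕ → ℕ} {n l : ℕ}
    (h : ∀ k ≤ n, blockSum a k l = blockSum b k l) {i : ℕ} (hi : i < n) :
    ∑ j ∈ Finset.range l, a i j = ∑ j ∈ Finset.range l, b i j := by
  have h1 := h i hi.le
  have h2 := h (i + 1) hi
  rw [blockSum_succ_left, blockSum_succ_left] at h2
  omega

/-! ### Rayleigh's principle and the positive eigenvector. -/

open Matrix in
/-- The adjacency matrix with the choice of decidability instance made in `lambdaOne`. -/
noncomputable def realAdj {V : Type*} [Fintype V] (G : SimpleGraph V) : Matrix V V ℝ :=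
  open Classical in G.adjMatrix ℝ

section Spectral

open Matrix

variable {V : Type*} [Fintype V] (G : SimpleGraph V)

lemma realAdj_apply (u v : V) [Decidable (G.Adj u v)] :
    realAdj G u v = if G.Adj u v then 1 else 0 := by
  classical
  simp only [realAdj, SimpleGraph.adjMatrix_apply]
  congr

lemma realAdj_isHermitian : (realAdj G).IsHermitian := by
  classical
  ext u v
  simp [realAdj_apply, G.adj_comm]

lemma mem_eigenvalues_iff [DecidableEq V] (μ : ℝ) :
    Module.End.HasEigenvalue (Matrix.toLin' (realAdj G)) μ ↔
      ∃ y : V → ℝ, y ≠ 0 ∧ realAdj G *ᵥ y = μ • y := by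
  constructor
  · intro h
    obtain ⟨y, hy⟩ := h.exists_hasEigenvector
    exact ⟨y, hy.2, by simpa using hy.apply_eq_smul⟩
  · rintro ⟨y, hy, h⟩
    exact Module.End.hasEigenvalue_of_hasEigenvector (x := y)
      ⟨Module.End.mem_eigenspace_iff.2 (by simpa using h), hy⟩

lemma lambdaOne_eq : lambdaOne G =
    sSup {μ : ℝ | ∃ y : V → ℝ, y ≠ 0 ∧ realAdj G *ᵥ y = μ • y} := by
  classical
  simp only [← mem_eigenvalues_iff]
  unfold lambdaOne realAdj
  congr!

lemma eigenvalues_eq_range [DecidableEq V] : {μ : ℝ | ∃ y : V → ℝ, y ≠ 0 ∧ realAdj G *ᵥ y = μ • y} =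
    Set.range (realAdj_isHermitian G).eigenvalues := by
  rw [← (realAdj_isHermitian G).spectrum_real_eq_range_eigenvalues]
  ext μ
  rw [Set.mem_ofPred_eq, ← mem_eigenvalues_iff, Module.End.hasEigenvalue_iff_mem_spectrum,
    Matrix.spectrum_toLin']

lemma exists_eigenvector_lambdaOne [Nonempty V] :
    ∃ y : V → ℝ, y ≠ 0 ∧ realAdj G *ᵥ y = lambdaOne G • y := by
  classical
  have h : lambdaOne G ∈ {μ : ℝ | ∃ y : V → ℝ, y ≠ 0 ∧ realAdj G *ᵥ y = μ • y} := by
    rw [lambdaOne_eq, eigenvalues_eq_range]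
    exact (Set.range_nonempty _).csSup_mem (Set.finite_range _)
  exact h

/-- This form of Rayleigh's principle also covers its equality case, since a positive semidefinite
form vanishes only on the kernel. -/
lemma posSemidef_lambdaOne_sub [DecidableEq V] :
    (lambdaOne G • (1 : Matrix V V ℝ) - realAdj G).PosSemidef := by
  have hH : (lambdaOne G • (1 : Matrix V V ℝ) - realAdj G).IsHermitian :=
    (Matrix.isHermitian_one.smul (IsSelfAdjoint.all _)).sub (realAdj_isHermitian G)
  rw [Matrix.posSemidef_iff_isHermitian_and_spectrum_nonneg]
  refine ⟨hH, fun μ hμ => ?_⟩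
  rw [← Matrix.spectrum_toLin', ← Module.End.hasEigenvalue_iff_mem_spectrum] at hμ
  obtain ⟨y, hy⟩ := hμ.exists_hasEigenvector
  have h1 : lambdaOne G • y - realAdj G *ᵥ y = μ • y := by
    simpa [Matrix.sub_mulVec, Matrix.smul_mulVec] using hy.apply_eq_smul
  have h2 : lambdaOne G - μ ∈ {μ : ℝ | ∃ y : V → ℝ, y ≠ 0 ∧ realAdj G *ᵥ y = μ • y} :=
    ⟨y, hy.2, by rw [sub_smul, ← h1]; abel⟩
  have h3 : lambdaOne G - μ ≤ lambdaOne G := by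
    conv_rhs => rw [lambdaOne_eq]
    refine le_csSup ?_ h2
    rw [eigenvalues_eq_range]
    exact (Set.finite_range _).bddAbove
  simp only [Set.mem_ofPred_eq]
  linarith

lemma quadratic_form_le_lambdaOne (y : V → ℝ) :
    y ⬝ᵥ realAdj G *ᵥ y ≤ lambdaOne G * (y ⬝ᵥ y) := by
  classical
  have := (posSemidef_lambdaOne_sub G).dotProduct_mulVec_nonneg y
  simp only [star_trivial, Matrix.sub_mulVec, Matrix.smul_mulVec, Matrix.one_mulVec,
    dotProduct_sub, dotProduct_smul, smul_eq_mul] at this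
  linarith

lemma mulVec_eq_of_quadratic_form_eq {y : V → ℝ}
    (h : y ⬝ᵥ realAdj G *ᵥ y = lambdaOne G * (y ⬝ᵥ y)) :
    realAdj G *ᵥ y = lambdaOne G • y := by
  classical
  have := ((posSemidef_lambdaOne_sub G).dotProduct_mulVec_zero_iff y).1 (by
    simp only [star_trivial, Matrix.sub_mulVec, Matrix.smul_mulVec, Matrix.one_mulVec,
      dotProduct_sub, dotProduct_smul, smul_eq_mul]
    linarith)
  rw [Matrix.sub_mulVec, Matrix.smul_mulVec, Matrix.one_mulVec, sub_eq_zero] at this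
  exact this.symm

variable {G}

/-- A connected graph has a positive eigenvector for its largest eigenvalue. -/
lemma exists_pos_eigenvector (hG : G.Connected) :
    ∃ y : V → ℝ, (∀ v, 0 < y v) ∧ realAdj G *ᵥ y = lambdaOne G • y := by
  classical
  have := hG.nonempty
  obtain ⟨z, hz0, hz⟩ := exists_eigenvector_lambdaOne G
  -- Taking absolute values keeps the norm and does not decrease the quadratic form, so the result
  -- is again an eigenvector.
  set y : V → ℝ := fun v => |z v|
  have hyy : y ⬝ᵥ y = z ⬝ᵥ z := by simp [dotProduct, y]
  have hle : z ⬝ᵥ realAdj G *ᵥ z ≤ y ⬝ᵥ realAdj G *ᵥ y := by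
    simp only [dotProduct, mulVec, Finset.mul_sum]
    refine Finset.sum_le_sum fun u _ => Finset.sum_le_sum fun v _ => ?_
    refine (le_abs_self _).trans ?_
    rw [abs_mul, abs_mul]
    rw [abs_of_nonneg (a := realAdj G u v) (by rw [realAdj_apply]; split_ifs <;> norm_num)]
  have hy : realAdj G *ᵥ y = lambdaOne G • y := by
    refine mulVec_eq_of_quadratic_form_eq G (le_antisymm (quadratic_form_le_lambdaOne G y) ?_)
    rw [hyy]
    refine le_trans ?_ hle
    rw [hz, dotProduct_smul, smul_eq_mul]
  have hyv : ∀ v, ∑ u, (if G.Adj v u then y u else 0) = lambdaOne G * y v := fun v => by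
    have := congrFun hy v
    simpa [mulVec, dotProduct, realAdj_apply] using this
  -- At a zero of `y` the neighbouring entries are nonnegative with sum zero, so zeros spread along
  -- edges.
  have hstep : ∀ v u, G.Adj v u → y v = 0 → y u = 0 := by
    intro v u hvu hv
    have h0 := hyv v
    rw [hv, mul_zero, Finset.sum_eq_zero_iff_of_nonneg
      (fun u _ => by split_ifs <;> simp [y])] at h0
    simpa [hvu] using h0 u (Finset.mem_univ _)
  refine ⟨y, fun v => lt_of_le_of_ne (abs_nonneg _) fun hv => hz0 ?_, hy⟩
  funext w
  have hw : y w = 0 := by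
    obtain ⟨p⟩ := hG.preconnected v w
    have : ∀ {a b : V}, G.Walk a b → y a = 0 → y b = 0 := by
      intro a b p
      induction p with
      | nil => exact id
      | cons h _ ih => exact fun ha => ih (hstep _ _ h ha)
    exact this p hv.symm
  simpa [y] using hw

lemma realAdj_mulVec_comp {W : Type*} [Fintype W] {H : SimpleGraph W} (e : G ≃g H) (y : W → ℝ) :
    realAdj G *ᵥ (y ∘ e) = (realAdj H *ᵥ y) ∘ e := by
  classical
  funext v
  simp only [mulVec, dotProduct, Function.comp_apply]
  exact Fintype.sum_equiv e.toEquiv _ _ fun u => by simp [realAdj_apply, ← e.map_adj_iff]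

lemma lambdaOne_congr {W : Type*} [Fintype W] {H : SimpleGraph W} (e : G ≃g H) :
    lambdaOne G = lambdaOne H := by
  have key := realAdj_mulVec_comp e
  rw [lambdaOne_eq, lambdaOne_eq]
  congr 1
  ext μ
  constructor
  · rintro ⟨y, hy, h⟩
    have hye : (y ∘ e.symm) ∘ e = y := by funext v; simp
    refine ⟨y ∘ e.symm, fun h0 => hy ?_, ?_⟩
    · rw [← hye, h0]; rfl
    · have := key (y ∘ e.symm)
      rw [hye, h] at this
      funext w
      simpa using (congrFun this (e.symm w)).symm
  · rintro ⟨y, hy, h⟩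
    refine ⟨y ∘ e, fun h0 => hy ?_, by rw [key, h]; rfl⟩
    funext w
    simpa using congrFun h0 (e.symm w)

end Spectral

/-! ### Adding a vertex, and graphs given by matrices. -/

section AddVertex

variable {m : ℕ} {G H : SimpleGraph (Fin m)} {S T : Set (Fin m)}

@[simp] lemma addVertex_adj_castSucc {u v : Fin m} :
    (addVertex G S).Adj u.castSucc v.castSucc ↔ G.Adj u v := by
  simp only [addVertex, SimpleGraph.sup_adj, SimpleGraph.fromRel_adj]
  constructor
  · rintro (h | ⟨_, ⟨h, _⟩ | ⟨h, _⟩⟩)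
    · simpa using (SimpleGraph.map_adj_apply (f := Fin.castSuccEmb)).1 h
    · exact absurd h (Fin.castSucc_lt_last _).ne
    · exact absurd h (Fin.castSucc_lt_last _).ne
  · exact fun h => Or.inl ((SimpleGraph.map_adj_apply (f := Fin.castSuccEmb)).2 h)

@[simp] lemma addVertex_adj_last {u : Fin m} :
    (addVertex G S).Adj u.castSucc (Fin.last m) ↔ u ∈ S := by
  simp only [addVertex, SimpleGraph.sup_adj, SimpleGraph.fromRel_adj]
  constructor
  · rintro (h | ⟨_, ⟨_, s, hs, h⟩ | ⟨h, _⟩⟩)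
    · obtain ⟨_, b, _, _, hb⟩ := (SimpleGraph.map_adj Fin.castSuccEmb G _ _).1 h
      exact absurd hb (Fin.castSucc_lt_last _).ne
    · rwa [Fin.castSucc_injective _ h]
    · exact absurd h (Fin.castSucc_lt_last _).ne
  · exact fun h => Or.inr ⟨(Fin.castSucc_lt_last _).ne, Or.inl ⟨trivial, u, h, rfl⟩⟩

lemma eq_addVertex {K : SimpleGraph (Fin (m + 1))}
    (h : ∀ u v : Fin m, K.Adj u.castSucc v.castSucc ↔ G.Adj u v)
    (hS : ∀ u : Fin m, K.Adj u.castSucc (Fin.last m) ↔ u ∈ S) : K = addVertex G S := by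
  ext u v
  induction u using Fin.lastCases with
  | last =>
    induction v using Fin.lastCases with
    | last => simp
    | cast v =>
      rw [K.adj_comm, SimpleGraph.adj_comm (addVertex G S), hS, addVertex_adj_last]
  | cast u =>
    induction v using Fin.lastCases with
    | last => rw [hS, addVertex_adj_last]
    | cast v => rw [h, addVertex_adj_castSucc]

/-- An isomorphism that respects the attaching sets extends to the graphs with a new vertex. -/
lemma nonempty_addVertex_iso (e : G ≃g H) (h : ∀ v, v ∈ S ↔ e v ∈ T) :
    Nonempty (addVertex G S ≃g addVertex H T) := by
  let f : Fin (m + 1) ≃ Fin (m + 1) :=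
    (finSuccEquivLast.trans (Equiv.optionCongr e.toEquiv)).trans finSuccEquivLast.symm
  have hf : ∀ u : Fin m, f u.castSucc = (e u).castSucc := fun u => by simp [f]
  have hl : f (Fin.last m) = Fin.last m := by simp [f]
  refine ⟨f, ?_⟩
  intro u v
  induction u using Fin.lastCases with
  | last =>
    induction v using Fin.lastCases with
    | last => simp
    | cast v =>
      rw [hf, hl, SimpleGraph.adj_comm, addVertex_adj_last, SimpleGraph.adj_comm,
        addVertex_adj_last, h]
  | cast u =>
    induction v using Fin.lastCases with
    | last => rw [hf, hl, addVertex_adj_last, addVertex_adj_last, h]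
    | cast v => rw [hf, hf, addVertex_adj_castSucc, addVertex_adj_castSucc, e.map_adj_iff]

end AddVertex

lemma mem_unsaturated_iff_of_iso {V W : Type*} [Fintype V] [Fintype W] {G : SimpleGraph V}
    {H : SimpleGraph W} (e : G ≃g H) (v : V) : v ∈ unsaturated G ↔ e v ∈ unsaturated H := by
  classical
  simp only [unsaturated, Set.mem_ofPred_eq]
  rw [← e.degree_eq v]

/-- The graph on `Fin m` with the adjacency given by the nonzero entries of `a`. -/
def matrixGraph (a : ℕ → ℕ → ℕ) (m : ℕ) : SimpleGraph (Fin m) :=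
  SimpleGraph.fromRel fun i j => a i j ≠ 0

section MatrixGraph

variable {a : ℕ → ℕ → ℕ}

lemma matrixGraph_adj (hs : ∀ i j, a i j = a j i) (hd : ∀ i, a i i = 0)
    {m : ℕ} {u v : Fin m} : (matrixGraph a m).Adj u v ↔ a u v ≠ 0 := by
  rw [matrixGraph, SimpleGraph.fromRel_adj, hs v u, or_self]
  exact ⟨fun h => h.2, fun h => ⟨fun huv => h (huv ▸ hd u), h⟩⟩

lemma matrixGraph_succ (hs : ∀ i j, a i j = a j i) (hd : ∀ i, a i i = 0) (m : ℕ) :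
    matrixGraph a (m + 1) = addVertex (matrixGraph a m) {v | a v m ≠ 0} :=
  eq_addVertex (fun u v => by simp [matrixGraph_adj hs hd])
    (fun u => by simp [matrixGraph_adj hs hd])

lemma degree_matrixGraph (hs : ∀ i j, a i j = a j i) (hd : ∀ i, a i i = 0)
    (h1 : ∀ i j, a i j ≤ 1) {m : ℕ} (v : Fin m) [Fintype ((matrixGraph a m).neighborSet v)] :
    (matrixGraph a m).degree v = ∑ j ∈ Finset.range m, a v j := by
  classical
  rw [Finset.sum_range, ← SimpleGraph.card_neighborFinset_eq_degree, Finset.card_eq_sum_ones,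
    ← Finset.sum_filter_add_sum_filter_not Finset.univ (fun j : Fin m => a v j ≠ 0)]
  rw [Finset.sum_eq_zero (s := Finset.univ.filter fun j : Fin m => ¬ a v j ≠ 0) (by simp), add_zero]
  refine Finset.sum_congr (by ext; simp [matrixGraph_adj hs hd]) fun j hj => ?_
  have := h1 v j
  have := (Finset.mem_filter.1 hj).2
  omega

lemma unsaturated_matrixGraph (hs : ∀ i j, a i j = a j i) (hd : ∀ i, a i i = 0)
    (h1 : ∀ i j, a i j ≤ 1) (m : ℕ) :
    unsaturated (matrixGraph a m) = {v : Fin m | ∑ j ∈ Finset.range m, a v j < 3} := by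
  classical
  ext v
  simp [unsaturated, degree_matrixGraph hs hd h1]

end MatrixGraph

/-! ### The ladder as a model of every outcome of the recursive construction. -/

lemma ladderMatrix_self (i : ℕ) : ladderMatrix i i = 0 := by
  unfold ladderMatrix
  rcases i with _ | _ | _ | _ | _ | _ | i <;> simp [ladderNbr]
  split_ifs <;> omega

lemma ladderMatrix_le_one (i j : ℕ) : ladderMatrix i j ≤ 1 := by
  unfold ladderMatrix
  rcases i with _ | _ | _ | _ | _ | _ | i <;> simp [ladderNbr] <;> grind

lemma ladderMatrix_ne_zero_iff {i j : ℕ} (hi : 6 ≤ i) :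
    ladderMatrix i j ≠ 0 ↔ j = i - 2 ∨ j = i + 2 ∨ (i % 2 = 0 ∧ j = i + 1) ∨
      (i % 2 = 1 ∧ j = i - 1) := by
  obtain ⟨i, rfl⟩ : ∃ m, i = m + 6 := ⟨i - 6, by omega⟩
  simp only [ladderMatrix, ladderNbr, Matrix.cons_val]
  grind

/-- The standard model of `B_m`. -/
abbrev ladderGraph (m : ℕ) : SimpleGraph (Fin m) := matrixGraph ladderMatrix m

lemma ladderGraph_adj {m : ℕ} {u v : Fin m} : (ladderGraph m).Adj u v ↔ ladderMatrix u v ≠ 0 :=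
  matrixGraph_adj ladderMatrix_symm ladderMatrix_self

lemma sum_ladderMatrix_lt_three_iff {i m : ℕ} (hm : 6 ≤ m) (hi : i < m) :
    ∑ j ∈ Finset.range m, ladderMatrix i j < 3 ↔ m ≤ i + 2 := by
  obtain h | rfl | rfl : i + 3 ≤ m ∨ m = i + 2 ∨ m = i + 1 := by omega
  · rw [sum_ladderMatrix_eq_three h hm]
    omega
  · rw [sum_ladderMatrix_add_two (by omega)]
    omega
  · rw [sum_ladderMatrix_add_one (by omega)]
    omega

lemma mem_unsaturated_ladderGraph {m : ℕ} (hm : 6 ≤ m) {v : Fin m} :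
    v ∈ unsaturated (ladderGraph m) ↔ m ≤ v + 2 := by
  rw [ladderGraph, unsaturated_matrixGraph ladderMatrix_symm ladderMatrix_self ladderMatrix_le_one]
  exact sum_ladderMatrix_lt_three_iff hm v.2

/-- The involution of the vertices that exchanges the two rails of the ladder. -/
def ladderFlip (i : ℕ) : ℕ :=
  if i < 4 then (i + 2) % 4 else if i % 2 = 0 then i + 1 else i - 1

lemma ladderFlip_ladderFlip (i : ℕ) : ladderFlip (ladderFlip i) = i := by
  unfold ladderFlip
  grind

lemma ladderFlip_lt {i m : ℕ} (hm : 6 ≤ m) (he : Even m) (hi : i < m) : ladderFlip i < m := by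
  obtain ⟨r, rfl⟩ := he
  unfold ladderFlip
  grind

lemma ladderMatrix_ladderFlip (i j : ℕ) :
    ladderMatrix (ladderFlip i) (ladderFlip j) = ladderMatrix i j := by
  have hinj : ∀ k, k = ladderFlip j ↔ ladderFlip k = j := fun k =>
    ⟨fun h => by rw [h, ladderFlip_ladderFlip], fun h => by rw [← h, ladderFlip_ladderFlip]⟩
  simp only [ladderMatrix, hinj]
  rcases i with _ | _ | _ | _ | _ | _ | i
  · simp [ladderFlip, ladderNbr]; grind
  · simp [ladderFlip, ladderNbr]; grind
  · simp [ladderFlip, ladderNbr]; grind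
  · simp [ladderFlip, ladderNbr]; grind
  · simp [ladderFlip, ladderNbr]; grind
  · simp [ladderFlip, ladderNbr]; grind
  · rcases Nat.mod_two_eq_zero_or_one i with h | h
    · have e : ladderFlip (i + 6) = (i + 1) + 6 := by unfold ladderFlip; grind
      rw [e]
      simp only [ladderNbr]
      have e0 : ladderFlip (i + 1 + 4) = i + 4 := by unfold ladderFlip; grind
      have e1 : ladderFlip (i + 1 + 5) = i + 7 := by unfold ladderFlip; grind
      have e2 : ladderFlip (i + 1 + 8) = i + 8 := by unfold ladderFlip; grind
      have h' : ¬ (i + 1) % 2 = 0 := by omega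
      simp [h, h', e0, e1, e2]
    · obtain ⟨i, rfl⟩ : ∃ r, i = r + 1 := ⟨i - 1, by omega⟩
      have e : ladderFlip (i + 1 + 6) = i + 6 := by unfold ladderFlip; grind
      rw [e]
      simp only [ladderNbr]
      have e0 : ladderFlip (i + 4) = i + 1 + 4 := by unfold ladderFlip; grind
      have e1 : ladderFlip (i + 7) = i + 6 := by unfold ladderFlip; grind
      have e2 : ladderFlip (i + 8) = i + 1 + 8 := by unfold ladderFlip; grind
      have h' : i % 2 = 0 := by omega
      simp [h, h', e0, e1, e2]

/-- Exchanging the rails is an automorphism of the ladder graph of even order. -/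
def ladderFlipIso {m : ℕ} (hm : 6 ≤ m) (he : Even m) : ladderGraph m ≃g ladderGraph m where
  toFun i := ⟨ladderFlip i, ladderFlip_lt hm he i.2⟩
  invFun i := ⟨ladderFlip i, ladderFlip_lt hm he i.2⟩
  left_inv i := Fin.ext (ladderFlip_ladderFlip i)
  right_inv i := Fin.ext (ladderFlip_ladderFlip i)
  map_rel_iff' := by
    intro u v
    simp [ladderGraph_adj, ladderMatrix_ladderFlip]

lemma nonempty_ladderGraph_six_iso : Nonempty (ladderGraph 6 ≃g
    (completeBipartiteGraph (Fin 3) (Fin 3)).deleteEdges {s(Sum.inl 0, Sum.inr 0)}) := by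
  let f : Fin 6 → Fin 3 ⊕ Fin 3 :=
    ![Sum.inr 1, Sum.inr 2, Sum.inl 1, Sum.inl 2, Sum.inl 0, Sum.inr 0]
  have hf : Function.Bijective f := by decide
  refine ⟨Equiv.ofBijective f hf, ?_⟩
  intro u v
  rw [ladderGraph_adj]
  simp only [Equiv.ofBijective_apply, SimpleGraph.deleteEdges_adj, completeBipartiteGraph_adj,
    Set.mem_singleton_iff]
  revert u v
  decide

lemma IsB.six_le {n : ℕ} {B : SimpleGraph (Fin n)} (h : IsB n B) : 6 ≤ n := by
  induction h <;> omega

/-- In a ladder on `m` vertices the unsaturated ones are `m - 2` and `m - 1`. For even `m` the flip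
exchanges them, so either choice at an odd step gives the same graph. -/
theorem IsB.nonempty_iso_ladderGraph {n : ℕ} {B : SimpleGraph (Fin n)} (h : IsB n B) :
    Nonempty (B ≃g ladderGraph n) := by
  induction h with
  | base B h => exact ⟨h.some.trans nonempty_ladderGraph_six_iso.some.symm⟩
  | odd_step m B hB hm v hv ih =>
    obtain ⟨e⟩ := ih
    have h6 := hB.six_le
    have heven : Even m := by rcases hm with ⟨r, hr⟩; exact ⟨r, by omega⟩
    have hev : m ≤ e v + 2 :=
      (mem_unsaturated_ladderGraph h6).1 ((mem_unsaturated_iff_of_iso e v).1 hv)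
    -- For even `m` the ladder itself attaches its new vertex `m` to `m - 2`.
    obtain ⟨e', he'⟩ : ∃ e' : B ≃g ladderGraph m, (e' v : ℕ) = m - 2 := by
      obtain h | h : (e v : ℕ) = m - 2 ∨ (e v : ℕ) = m - 1 := by have := (e v).2; omega
      · exact ⟨e, h⟩
      · refine ⟨e.trans (ladderFlipIso h6 heven), ?_⟩
        change ladderFlip (e v) = m - 2
        rw [h]
        obtain ⟨r, rfl⟩ := heven
        unfold ladderFlip
        grind
    rw [ladderGraph, matrixGraph_succ ladderMatrix_symm ladderMatrix_self]
    refine nonempty_addVertex_iso e' fun u => ?_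
    rw [Set.mem_singleton_iff, Set.mem_ofPred_eq, ladderMatrix_symm, ladderMatrix_ne_zero_iff h6,
      ← e'.injective.eq_iff, Fin.ext_iff, he']
    have := (e' u).2
    obtain ⟨r, rfl⟩ := heven
    omega
  | even_step m B hB hm ih =>
    obtain ⟨e⟩ := ih
    have h6 := hB.six_le
    rw [ladderGraph, matrixGraph_succ ladderMatrix_symm ladderMatrix_self]
    refine nonempty_addVertex_iso e fun u => ?_
    rw [mem_unsaturated_iff_of_iso e, mem_unsaturated_ladderGraph h6, Set.mem_ofPred_eq,
      ladderMatrix_symm, ladderMatrix_ne_zero_iff h6]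
    have := (e u).2
    obtain ⟨r, hr⟩ := hm
    omega

theorem exists_isB {n : ℕ} (hn : 6 ≤ n) : ∃ B : SimpleGraph (Fin n), IsB n B := by
  induction n, hn using Nat.le_induction with
  | base => exact ⟨_, IsB.base _ nonempty_ladderGraph_six_iso⟩
  | succ m hm ih =>
    obtain ⟨B, hB⟩ := ih
    rcases Nat.even_or_odd (m + 1) with h | h
    · exact ⟨_, IsB.even_step m B hB h⟩
    · obtain ⟨e⟩ := hB.nonempty_iso_ladderGraph
      refine ⟨_, IsB.odd_step m B hB h (e.symm ⟨m - 1, by omega⟩) ?_⟩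
      rw [mem_unsaturated_iff_of_iso e, e.apply_symm_apply, mem_unsaturated_ladderGraph hm]
      simp only
      omega

/-! ### The ladder graph is a connected subcubic bipartite graph. -/

section Subcubic

variable {V W : Type*} [Fintype V] [Fintype W] {G : SimpleGraph V} {H : SimpleGraph W}

lemma isConnectedSubcubicBipartite_iff [DecidableRel G.Adj] : IsConnectedSubcubicBipartite G ↔
    G.Connected ∧ G.IsBipartite ∧ (∀ v, G.degree v ≤ 3) ∧ (∃ v, G.degree v = 3) ∧
      ∃ v, G.degree v < 3 := by
  classical
  have hdeg : ∀ (v : V) (i j : Fintype (G.neighborSet v)),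
      @SimpleGraph.degree V G v i = @SimpleGraph.degree V G v j := fun v i j => by congr!
  constructor
  · rintro ⟨hc, hb, hi, hm⟩
    have := hc.nonempty
    have hle : ∀ v, G.degree v ≤ 3 := fun v => by
      have := G.degree_le_maxDegree v
      convert this using 1
      rw [← hm]
      congr!
    refine ⟨hc, hb, hle, ?_, ?_⟩
    · obtain ⟨v, hv⟩ := G.exists_maximal_degree_vertex
      refine ⟨v, ?_⟩
      rw [← hv, ← hm]
      congr!
    · by_contra! hcon
      exact hi ⟨3, fun v => by
        rw [hdeg v _ inferInstance]
        exact le_antisymm (hle v) (hcon v)⟩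
  · rintro ⟨hc, hb, hle, ⟨u, hu⟩, v, hv⟩
    refine ⟨hc, hb, ?_, ?_⟩
    · rintro ⟨d, hd⟩
      have h1 := hd u
      have h2 := hd v
      rw [hdeg u _ inferInstance] at h1
      rw [hdeg v _ inferInstance] at h2
      omega
    · have h1 : G.maxDegree = 3 :=
        le_antisymm (G.maxDegree_le_of_forall_degree_le _ hle) (hu ▸ G.degree_le_maxDegree u)
      rw [← h1]
      congr!

lemma IsConnectedIrregularBipartite.of_iso (e : G ≃g H) (h : IsConnectedSubcubicBipartite G) :
    IsConnectedSubcubicBipartite H := by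
  classical
  rw [isConnectedSubcubicBipartite_iff] at h ⊢
  obtain ⟨hc, hb, hle, ⟨u, hu⟩, v, hv⟩ := h
  refine ⟨e.connected_iff.1 hc, SimpleGraph.Colorable.of_hom e.symm.toHom hb, fun w => ?_, ⟨e u, ?_⟩,
    e v, ?_⟩
  · rw [← e.symm.degree_eq]; exact hle _
  · rwa [e.degree_eq]
  · rwa [e.degree_eq]

end Subcubic

lemma ladderGraph_connected {m : ℕ} (hm : 6 ≤ m) : (ladderGraph m).Connected := by
  have key : ∀ i (hi : i < m), (ladderGraph m).Reachable ⟨0, by omega⟩ ⟨i, hi⟩ := by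
    intro i
    induction i using Nat.strong_induction_on with
    | _ i ih =>
      intro hi
      have step : ∀ j, j < i → ladderMatrix j i ≠ 0 →
          (ladderGraph m).Reachable ⟨0, by omega⟩ ⟨i, hi⟩ := fun j hj h =>
        (ih j hj (by omega)).trans (SimpleGraph.Adj.reachable (ladderGraph_adj.2 h))
      rcases Nat.lt_or_ge i 6 with h6 | h6
      · interval_cases i
        · exact SimpleGraph.Reachable.refl _
        · exact ((SimpleGraph.Adj.reachable (v := (⟨2, by omega⟩ : Fin m))
            (ladderGraph_adj.2 (by decide : ladderMatrix 0 2 ≠ 0))).trans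
            (SimpleGraph.Adj.reachable (ladderGraph_adj.2 (by decide : ladderMatrix 2 1 ≠ 0))))
        · exact step 0 (by omega) (by decide)
        · exact step 0 (by omega) (by decide)
        · exact step 0 (by omega) (by decide)
        · exact step 2 (by omega) (by decide)
      · exact step (i - 2) (by omega)
          (by rw [ladderMatrix_symm, ladderMatrix_ne_zero_iff h6]; exact Or.inl rfl)
  have : Nonempty (Fin m) := ⟨⟨0, by omega⟩⟩
  exact SimpleGraph.connected_iff_exists_forall_reachable _ |>.2 ⟨⟨0, by omega⟩, fun i => key i i.2⟩

lemma ladderGraph_isBipartite (m : ℕ) : (ladderGraph m).IsBipartite := by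
  -- A step along a rail changes the parity of `i / 2` and keeps that of `i`; a rung does the
  -- opposite.
  let c : ℕ → Fin 2 := fun i => if i < 4 then (if i < 2 then 1 else 0) else
    if (i / 2 + i) % 2 = 0 then 0 else 1
  have hc : ∀ i j, ladderMatrix i j ≠ 0 → c i ≠ c j := by
    intro i j hij
    rcases Nat.lt_or_ge i 6 with hi | hi
    · have h3 : ladderNbr i 0 = j ∨ ladderNbr i 1 = j ∨ ladderNbr i 2 = j := by
        unfold ladderMatrix at hij
        grind
      interval_cases i <;> rcases h3 with rfl | rfl | rfl <;> decide
    · rw [ladderMatrix_ne_zero_iff hi] at hij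
      simp only [c]
      grind
  exact ⟨SimpleGraph.Coloring.mk (fun i => c i) fun {u v} h => hc u v (ladderGraph_adj.1 h)⟩

lemma sum_ladderMatrix_le (i l : ℕ) : ∑ j ∈ Finset.range l, ladderMatrix i j ≤ 3 := by
  rw [sum_ladderMatrix]
  split_ifs <;> omega

lemma ladderGraph_isConnectedSubcubicBipartite {m : ℕ} (hm : 6 ≤ m) :
    IsConnectedSubcubicBipartite (ladderGraph m) := by
  classical
  rw [isConnectedSubcubicBipartite_iff]
  have hdeg : ∀ v : Fin m, (ladderGraph m).degree v = ∑ j ∈ Finset.range m, ladderMatrix v j :=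
    fun v => degree_matrixGraph ladderMatrix_symm ladderMatrix_self ladderMatrix_le_one v
  refine ⟨ladderGraph_connected hm, ladderGraph_isBipartite m, fun v => ?_,
    ⟨⟨0, by omega⟩, ?_⟩, ⟨m - 1, by omega⟩, ?_⟩
  · rw [hdeg]
    exact sum_ladderMatrix_le _ _
  · rw [hdeg]
    exact sum_ladderMatrix_eq_three (by simp; omega) hm
  · rw [hdeg, sum_ladderMatrix_lt_three_iff hm (by simp; omega)]
    simp only
    omega

/-! ### The matrix of a connected subcubic bipartite graph. -/

open Classical in
/-- The adjacency matrix of a graph on `Fin n`, extended by zero to all natural numbers. -/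
noncomputable def natMatrix {n : ℕ} (G : SimpleGraph (Fin n)) (i j : ℕ) : ℕ :=
  if ∃ (hi : i < n) (hj : j < n), G.Adj ⟨i, hi⟩ ⟨j, hj⟩ then 1 else 0

section NatMatrix

variable {n : ℕ} (G : SimpleGraph (Fin n))

lemma natMatrix_symm (i j : ℕ) : natMatrix G i j = natMatrix G j i := by
  unfold natMatrix
  congr 1
  simp only [eq_iff_iff]
  exact ⟨fun ⟨h1, h2, h⟩ => ⟨h2, h1, h.symm⟩, fun ⟨h1, h2, h⟩ => ⟨h2, h1, h.symm⟩⟩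

lemma natMatrix_self (i : ℕ) : natMatrix G i i = 0 := by
  simp [natMatrix]

lemma natMatrix_le_one (i j : ℕ) : natMatrix G i j ≤ 1 := by
  unfold natMatrix
  split_ifs <;> omega

lemma natMatrix_ne_zero_iff {i j : ℕ} :
    natMatrix G i j ≠ 0 ↔ ∃ (hi : i < n) (hj : j < n), G.Adj ⟨i, hi⟩ ⟨j, hj⟩ := by
  simp [natMatrix]

lemma matrixGraph_natMatrix : matrixGraph (natMatrix G) n = G := by
  ext u v
  rw [matrixGraph_adj (natMatrix_symm G) (natMatrix_self G), natMatrix_ne_zero_iff]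
  exact ⟨fun ⟨_, _, h⟩ => h, fun h => ⟨u.2, v.2, h⟩⟩

lemma degree_eq_sum_natMatrix (v : Fin n) [Fintype (G.neighborSet v)] :
    G.degree v = ∑ j ∈ Finset.range n, natMatrix G v j := by
  classical
  rw [← degree_matrixGraph (natMatrix_symm G) (natMatrix_self G) (natMatrix_le_one G) v]
  congr!
  exact (matrixGraph_natMatrix G).symm

variable {G}

lemma natMatrix_eq_zero_of_le {i j : ℕ} (h : n ≤ i ∨ n ≤ j) : natMatrix G i j = 0 := by
  by_contra hc
  obtain ⟨_, _, _⟩ := (natMatrix_ne_zero_iff G).1 hc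
  omega

lemma sum_natMatrix_le (hG : IsConnectedSubcubicBipartite G) (i l : ℕ) :
    ∑ j ∈ Finset.range l, natMatrix G i j ≤ 3 := by
  classical
  rw [isConnectedSubcubicBipartite_iff] at hG
  have h1 : ∑ j ∈ Finset.range l, natMatrix G i j ≤ ∑ j ∈ Finset.range n, natMatrix G i j := by
    refine Finset.sum_le_sum_of_ne_zero fun j _ hj => ?_
    by_contra hc
    exact hj (natMatrix_eq_zero_of_le (Or.inr (by simpa using hc)))
  rcases Nat.lt_or_ge i n with hi | hi
  · refine h1.trans ?_
    have := hG.2.2.1 ⟨i, hi⟩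
    rwa [degree_eq_sum_natMatrix] at this
  · rw [Finset.sum_eq_zero fun j _ => natMatrix_eq_zero_of_le (Or.inl hi)]
    omega

/-- Otherwise the first `k` vertices have three neighbours each among themselves. They are then
closed under adjacency, hence all vertices by connectedness, and no vertex is unsaturated. -/
lemma blockSum_natMatrix_ne (hG : IsConnectedSubcubicBipartite G) {k : ℕ} (hk : 1 ≤ k)
    (hkn : k ≤ n) : blockSum (natMatrix G) k k ≠ 3 * k := by
  classical
  intro h
  have hle := sum_natMatrix_le hG
  have hrow : ∀ i < k, ∑ j ∈ Finset.range k, natMatrix G i j = 3 := by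
    by_contra! hc
    obtain ⟨i, hi, hne⟩ := hc
    have : blockSum (natMatrix G) k k < ∑ _i ∈ Finset.range k, 3 :=
      Finset.sum_lt_sum (fun i _ => hle i k)
        ⟨i, Finset.mem_range.2 hi, lt_of_le_of_ne (hle i k) hne⟩
    simp at this
    omega
  have hclosed : ∀ u v : Fin n, G.Adj u v → (u : ℕ) < k → (v : ℕ) < k := by
    intro u v huv hu
    by_contra hv
    have h1 := hle u (v + 1)
    have h2 := hrow u hu
    have h3 : ∑ j ∈ Finset.range k, natMatrix G u j ≤ ∑ j ∈ Finset.range v, natMatrix G u j :=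
      Finset.sum_le_sum_of_subset (Finset.range_subset_range.2 (by omega))
    have h4 := (natMatrix_ne_zero_iff G).2 ⟨u.2, v.2, huv⟩
    rw [Finset.sum_range_succ] at h1
    omega
  have hall : ∀ v : Fin n, (v : ℕ) < k := by
    intro v
    obtain ⟨p⟩ := hG.connected.preconnected ⟨0, by omega⟩ v
    have : ∀ {a b : Fin n}, G.Walk a b → (a : ℕ) < k → (b : ℕ) < k := by
      intro a b p
      induction p with
      | nil => exact id
      | cons h _ ih => exact fun ha => ih (hclosed _ _ h ha)
    exact this p hk
  obtain ⟨_, _, _, _, v, hv⟩ := isConnectedSubcubicBipartite_iff.1 hG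
  have hkn' : k = n := by
    by_contra hne
    have := hall ⟨k, by omega⟩
    simp at this
  have := hrow v (hall v)
  rw [degree_eq_sum_natMatrix] at hv
  rw [hkn'] at this
  omega

lemma exists_isSubcubicMatrix (hG : IsConnectedSubcubicBipartite G) :
    ∃ s : ℕ → Bool, s 0 = true ∧ IsSubcubicMatrix n s (natMatrix G) := by
  obtain ⟨c⟩ := hG.bipartite
  obtain ⟨z⟩ := hG.connected.nonempty
  have hn : 0 < n := z.pos
  -- The side is measured relative to vertex 0, as `placement` expects. Its value beyond `n` is
  -- immaterial because the matrix vanishes there.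
  refine ⟨fun i => if h : i < n then decide (c ⟨i, h⟩ = c ⟨0, hn⟩) else true, by simp [hn],
    natMatrix_le_one G, natMatrix_symm G, fun i j hij => ?_, sum_natMatrix_le hG,
    fun k => blockSum_natMatrix_ne hG⟩
  by_contra hne
  obtain ⟨hi, hj, hadj⟩ := (natMatrix_ne_zero_iff G).1 hne
  have hc := c.valid hadj
  simp only [hi, hj, dif_pos, decide_eq_decide] at hij
  grind

end NatMatrix

/-! ### Recognizing the recursive construction from row sums. -/

/-- A bipartite graph with sides of size three from which only the edge between `4` and `5` is
missing is `K_{3,3}` with an edge deleted. -/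
lemma exists_equiv_deleteEdges (b₀ b₁ b₂ b₃ b₄ b₅ : Bool) :
    ![b₀, b₁, b₂, b₃, b₄, b₅] 4 ≠ ![b₀, b₁, b₂, b₃, b₄, b₅] 5 →
    (Finset.univ.filter fun i => ![b₀, b₁, b₂, b₃, b₄, b₅] i = true).card = 3 →
    ∃ f : Fin 6 ≃ Fin 3 ⊕ Fin 3, ∀ i j : Fin 6,
      ((completeBipartiteGraph (Fin 3) (Fin 3)).deleteEdges {s(Sum.inl 0, Sum.inr 0)}).Adj
        (f i) (f j) ↔ ![b₀, b₁, b₂, b₃, b₄, b₅] i ≠ ![b₀, b₁, b₂, b₃, b₄, b₅] j ∧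
          ¬ (i = 4 ∧ j = 5) ∧ ¬ (i = 5 ∧ j = 4) := by
  -- The ends 4 and 5 of the missing edge get rank 0. They come last on their sides, so the other
  -- two vertices of each side get ranks 1 and 2 by counting.
  let rank : (Fin 6 → Bool) → Fin 6 → Fin 3 := fun b i => if i = 4 ∨ i = 5 then 0 else
    Fin.ofNat 3 (Finset.univ.filter fun j : Fin 6 => j ≤ i ∧ b j = b i).card
  let f : (Fin 6 → Bool) → Fin 6 → Fin 3 ⊕ Fin 3 := fun b i =>
    if b i = b 4 then Sum.inl (rank b i) else Sum.inr (rank b i)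
  have hinj : ∀ b₀ b₁ b₂ b₃ b₄ b₅ : Bool,
      ![b₀, b₁, b₂, b₃, b₄, b₅] 4 ≠ ![b₀, b₁, b₂, b₃, b₄, b₅] 5 →
      (Finset.univ.filter fun i => ![b₀, b₁, b₂, b₃, b₄, b₅] i = true).card = 3 →
      Function.Injective (f ![b₀, b₁, b₂, b₃, b₄, b₅]) := by
    decide +kernel
  have hadj : ∀ b₀ b₁ b₂ b₃ b₄ b₅ : Bool,
      ![b₀, b₁, b₂, b₃, b₄, b₅] 4 ≠ ![b₀, b₁, b₂, b₃, b₄, b₅] 5 →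
      (Finset.univ.filter fun i => ![b₀, b₁, b₂, b₃, b₄, b₅] i = true).card = 3 →
      ∀ i j : Fin 6, (((f ![b₀, b₁, b₂, b₃, b₄, b₅] i).isLeft ∧
          (f ![b₀, b₁, b₂, b₃, b₄, b₅] j).isRight ∨ (f ![b₀, b₁, b₂, b₃, b₄, b₅] i).isRight ∧
          (f ![b₀, b₁, b₂, b₃, b₄, b₅] j).isLeft) ∧
          ¬ s(f ![b₀, b₁, b₂, b₃, b₄, b₅] i, f ![b₀, b₁, b₂, b₃, b₄, b₅] j) =
            s(Sum.inl 0, Sum.inr 0)) ↔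
        ![b₀, b₁, b₂, b₃, b₄, b₅] i ≠ ![b₀, b₁, b₂, b₃, b₄, b₅] j ∧
          ¬ (i = 4 ∧ j = 5) ∧ ¬ (i = 5 ∧ j = 4) := by
    decide +kernel
  intro h45 hcard
  refine ⟨Equiv.ofBijective _ ((Fintype.bijective_iff_injective_and_card _).2
    ⟨hinj _ _ _ _ _ _ h45 hcard, by simp⟩), fun i j => ?_⟩
  rw [← hadj _ _ _ _ _ _ h45 hcard]
  simp only [Equiv.ofBijective_apply, SimpleGraph.deleteEdges_adj, completeBipartiteGraph_adj,
    Set.mem_singleton_iff]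

section Recognition

variable {n : ℕ} {s : ℕ → Bool} {a : ℕ → ℕ → ℕ} {τ : Equiv.Perm ℕ}

set_option maxHeartbeats 1000000 in
-- The vertices 4 and 5 have both their neighbours among the first four, so they are not adjacent.
-- There are then eight edges, the maximum compatible with the degrees, and the bipartition
-- determines all of them.
lemma nonempty_matrixGraph_six_iso (h : IsSubcubicMatrix n s a)
    (h4 : ∀ i < 6, ∑ j ∈ Finset.range 4, a i j = 2)
    (h6 : ∀ i < 6, ∑ j ∈ Finset.range 6, a i j = if i < 4 then 3 else 2) :
    Nonempty (matrixGraph a 6 ≃g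
      (completeBipartiteGraph (Fin 3) (Fin 3)).deleteEdges {s(Sum.inl 0, Sum.inr 0)}) := by
  have hd := h.diag_eq_zero
  have key : (![s 0, s 1, s 2, s 3, s 4, s 5] 4 ≠ ![s 0, s 1, s 2, s 3, s 4, s 5] 5 ∧
      (Finset.univ.filter fun i => ![s 0, s 1, s 2, s 3, s 4, s 5] i = true).card = 3) ∧
      ∀ i j : Fin 6, a i j ≠ 0 ↔ ![s 0, s 1, s 2, s 3, s 4, s 5] i ≠
        ![s 0, s 1, s 2, s 3, s 4, s 5] j ∧ ¬ (i = 4 ∧ j = 5) ∧ ¬ (i = 5 ∧ j = 4) := by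
    have z : ∀ i j, s i = s j → a i j = 0 := h.bipartite
    have s01 := h.symm 1 0
    have s02 := h.symm 2 0
    have s03 := h.symm 3 0
    have s04 := h.symm 4 0
    have s05 := h.symm 5 0
    have s12 := h.symm 2 1
    have s13 := h.symm 3 1
    have s14 := h.symm 4 1
    have s15 := h.symm 5 1
    have s23 := h.symm 3 2
    have s24 := h.symm 4 2
    have s25 := h.symm 5 2
    have s34 := h.symm 4 3
    have s35 := h.symm 5 3
    have s45 := h.symm 5 4
    have p0 := h4 0 (by omega)
    have p1 := h4 1 (by omega)
    have p2 := h4 2 (by omega)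
    have p3 := h4 3 (by omega)
    have p4 := h4 4 (by omega)
    have p5 := h4 5 (by omega)
    have q0 := h6 0 (by omega)
    have q1 := h6 1 (by omega)
    have q2 := h6 2 (by omega)
    have q3 := h6 3 (by omega)
    have q4 := h6 4 (by omega)
    have q5 := h6 5 (by omega)
    simp only [Finset.sum_range_succ, Finset.sum_range_zero, zero_add, hd, s01, s02, s03, s04, s05,
      s12, s13, s14, s15, s23, s24, s25, s34, s35, s45] at p0 p1 p2 p3 p4 p5 q0 q1 q2 q3 q4 q5
    simp only [Nat.reduceLT, if_true, if_false] at q0 q1 q2 q3 q4 q5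
    have z01 := z 0 1
    have z02 := z 0 2
    have z03 := z 0 3
    have z04 := z 0 4
    have z05 := z 0 5
    have z12 := z 1 2
    have z13 := z 1 3
    have z14 := z 1 4
    have z15 := z 1 5
    have z23 := z 2 3
    have z24 := z 2 4
    have z25 := z 2 5
    have z34 := z 3 4
    have z35 := z 3 5
    have o01 := h.le_one 0 1
    have o02 := h.le_one 0 2
    have o03 := h.le_one 0 3
    have o04 := h.le_one 0 4
    have o05 := h.le_one 0 5
    have o12 := h.le_one 1 2
    have o13 := h.le_one 1 3
    have o14 := h.le_one 1 4
    have o15 := h.le_one 1 5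
    have o23 := h.le_one 2 3
    have o24 := h.le_one 2 4
    have o25 := h.le_one 2 5
    have o34 := h.le_one 3 4
    have o35 := h.le_one 3 5
    clear z h h4 h6
    generalize s 0 = b0, s 1 = b1, s 2 = b2, s 3 = b3, s 4 = b4, s 5 = b5 at *
    cases b0 <;> cases b1 <;> cases b2 <;> cases b3 <;> cases b4 <;> cases b5 <;>
    simp only [reduceCtorEq, forall_const, IsEmpty.forall_iff]
      at z01 z02 z03 z04 z05 z12 z13 z14 z15 z23 z24 z25 z34 z35 <;>
    first
    | (exfalso; omega)
    | (refine ⟨by decide, fun i j => ?_⟩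
       fin_cases i <;> fin_cases j <;> simp [hd] <;> omega)
  obtain ⟨f, hf⟩ := exists_equiv_deleteEdges _ _ _ _ _ _ key.1.1 key.1.2
  refine ⟨f, ?_⟩
  intro i j
  rw [matrixGraph_adj h.symm hd, key.2, hf]

/-- A subcubic matrix whose sums over complete blocks of columns agree with those of the ladder
graph comes from the recursive construction. -/
theorem isB_matrixGraph_of_sum_eq (h : IsSubcubicMatrix n s a) (hn : 6 ≤ n)
    (hτ : ∀ i, 4 ≤ i → τ i = i)
    (hrow : ∀ l, 4 ≤ l → l ≤ n → Even l ∨ l = n → ∀ i < n,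
      ∑ j ∈ Finset.range l, a i j = ∑ j ∈ Finset.range l, ladderPerm τ i j) :
    IsB n (matrixGraph a n) := by
  have hd := h.diag_eq_zero
  have hR : ∀ l, 4 ≤ l → l ≤ n → Even l ∨ l = n → ∀ i < n,
      ∑ j ∈ Finset.range l, a i j = ∑ j ∈ Finset.range l, ladderMatrix (τ i) j :=
    fun l hl hln hel i hi => by rw [hrow l hl hln hel i hi, sum_ladderPerm hτ i hl]
  have hτlt : ∀ i k, 4 ≤ k → i < k → τ i < k := fun i k hk hi => by
    rcases Nat.lt_or_ge i 4 with h | h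
    · exact (perm_lt hτ h).trans_le hk
    · rwa [hτ i h]
  suffices H : ∀ m, 6 ≤ m → m ≤ n → IsB m (matrixGraph a m) from H n hn le_rfl
  intro m hm
  induction m, hm using Nat.le_induction with
  | base =>
    intro _
    refine IsB.base _ (nonempty_matrixGraph_six_iso h (fun i hi => ?_) fun i hi => ?_)
    · rw [hR 4 (by omega) (by omega) (Or.inl (by decide)) i (by omega)]
      have := hτlt i 6 (by omega) hi
      interval_cases τ i <;> decide
    · rw [hR 6 (by omega) (by omega) (Or.inl (by decide)) i (by omega)]
      split_ifs with hi4
      · have := hτlt i 4 le_rfl hi4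
        interval_cases τ i <;> decide
      · rw [hτ i (by omega)]
        interval_cases i <;> decide
  | succ m hm ih =>
    intro hmn
    specialize ih (by omega)
    rw [matrixGraph_succ h.symm hd]
    rcases Nat.even_or_odd (m + 1) with he | ho
    · have hm7 : 7 ≤ m := by obtain ⟨r, hr⟩ := he; omega
      have hS : {v : Fin m | a v m ≠ 0} = unsaturated (matrixGraph a m) := by
        rw [unsaturated_matrixGraph h.symm hd h.le_one]
        ext v
        have hv := v.2
        simp only [Set.mem_ofPred_eq]
        have h1 := hR (m + 1) (by omega) hmn (Or.inl he) v (by omega)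
        have h2 := h.le_one v m
        -- Vertices before `m - 1` have degree three once `m` is present, so exactly the unsaturated
        -- ones are joined to `m`. Vertex `m - 1` has one neighbour before itself and two among the
        -- first `m + 1` vertices, so it is unsaturated and joined to `m`.
        rcases Nat.lt_or_ge (v + 1) m with hlt | hge
        · rw [sum_ladderMatrix_eq_three (by
            rcases Nat.lt_or_ge v 4 with h | h
            · have := hτlt v 4 le_rfl h
              omega
            · rw [hτ v h]; omega) (by omega), Finset.sum_range_succ] at h1
          omega
        · have hvm : (v : ℕ) = m - 1 := by omega
          have h3 := hR (m - 1) (by omega) (by omega)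
            (Or.inl (by obtain ⟨r, hr⟩ := he; exact ⟨r - 1, by omega⟩)) v (by omega)
          obtain ⟨k, rfl⟩ : ∃ k, m = k + 1 := ⟨m - 1, by omega⟩
          have hvk : (v : ℕ) = k := by omega
          rw [hvk, hτ k (by omega)] at h1 h3
          rw [sum_ladderMatrix_add_two (by omega), Finset.sum_range_succ,
            Finset.sum_range_succ] at h1
          simp only [Nat.add_sub_cancel] at h3
          have h4 := sum_ladderMatrix_add_one (i := k) (by omega)
          rw [Finset.sum_range_succ, ladderMatrix_self] at h4
          have hk2 : k % 2 = 0 := by obtain ⟨r, hr⟩ := he; omega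
          rw [hvk] at h2 ⊢
          rw [Finset.sum_range_succ]
          have := hd k
          omega
      rw [hS]
      exact IsB.even_step m _ ih he
    · have hme : Even m := by obtain ⟨r, hr⟩ := ho; exact ⟨r, by omega⟩
      -- The new vertex has a single earlier neighbour. Which one is not determined, but it was
      -- unsaturated because its degree is still at most three; this is the choice that the
      -- construction allows.
      have hsum : ∑ j ∈ Finset.range m, a m j = 1 := by
        rw [hR m (by omega) (by omega) (Or.inl hme) m (by omega), hτ m (by omega)]
        have h4 := sum_ladderMatrix_add_one (i := m) (by omega)
        rw [Finset.sum_range_succ, ladderMatrix_self] at h4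
        obtain ⟨r, hr⟩ := hme
        omega
      obtain ⟨w, hw, hw0⟩ : ∃ w ∈ Finset.range m, a m w ≠ 0 :=
        Finset.exists_ne_zero_of_sum_ne_zero (by omega)
      have hwm := Finset.mem_range.1 hw
      have hS : {v : Fin m | a v m ≠ 0} = {⟨w, hwm⟩} := by
        ext v
        simp only [Set.mem_ofPred_eq, Set.mem_singleton_iff]
        constructor
        · intro hv
          by_contra hne
          have hvw : (v : ℕ) ≠ w := fun h => hne (Fin.ext h)
          have := Finset.add_le_sum (f := fun j => a m j) (fun _ _ => Nat.zero_le _)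
            (Finset.mem_range.2 v.2) hw hvw
          rw [h.symm] at hv
          omega
        · rintro rfl
          rw [h.symm]
          exact hw0
      rw [hS]
      refine IsB.odd_step m _ ih ho _ ?_
      rw [unsaturated_matrixGraph h.symm hd h.le_one, Set.mem_ofPred_eq]
      have := h.row_le w (m + 1)
      rw [Finset.sum_range_succ, h.symm w m] at this
      simp only
      omega

end Recognition

/-! ### Strict drops in the eigenvector of the ladder. -/

section Eigenvector

variable {n : ℕ} {y : ℕ → ℝ} {μ : ℝ}

/-- In a nonnegative eigenvector of the ladder graph whose entries decrease along the ladder, the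
entry at `4` is smaller than the entries at `0, …, 3`, and the entries of consecutive rungs
differ. -/
lemma ladder_eigenvector_strict (hn : 6 ≤ n) (hμ : μ < 3) (hpos : ∀ i < n, 0 < y i)
    (hzero : ∀ i, n ≤ i → y i = 0) (hanti : ∀ i j, 5 ≤ i → i ≤ j → y j ≤ y i)
    (htop : ∀ i < 5, y 5 ≤ y i)
    (heig : ∀ i < n, y (ladderNbr i 0) + y (ladderNbr i 1) + y (ladderNbr i 2) = μ * y i) :
    (∀ i < 4, y 4 < y i) ∧ ∀ l, Even l → 6 ≤ l → l < n → y l < y (l - 1) := by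
  have e0 : y 2 + y 3 + y 4 = μ * y 0 := heig 0 (by omega)
  have e1 : y 2 + y 3 + y 4 = μ * y 1 := heig 1 (by omega)
  have e2 : y 0 + y 1 + y 5 = μ * y 2 := heig 2 (by omega)
  have e3 : y 0 + y 1 + y 5 = μ * y 3 := heig 3 (by omega)
  have e4 : y 0 + y 1 + y 6 = μ * y 4 := heig 4 (by omega)
  have e5 : y 2 + y 3 + y 7 = μ * y 5 := heig 5 (by omega)
  have p0 := hpos 0 (by omega)
  have p1 := hpos 1 (by omega)
  have p2 := hpos 2 (by omega)
  have p3 := hpos 3 (by omega)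
  have p4 := hpos 4 (by omega)
  have p5 := hpos 5 (by omega)
  have hnn : ∀ i, 0 ≤ y i := fun i => by
    rcases Nat.lt_or_ge i n with h | h
    · exact (hpos i h).le
    · exact (hzero i h).ge
  have hμ0 : 0 < μ := by
    by_contra hc
    nlinarith [mul_nonneg (neg_nonneg.2 (not_lt.1 hc)) p0.le]
  -- The vertices 0 and 1 have the same neighbours, and so have 2 and 3.
  have h01 : y 1 = y 0 := mul_left_cancel₀ hμ0.ne' (by linarith)
  have h23 : y 3 = y 2 := mul_left_cancel₀ hμ0.ne' (by linarith)
  rw [h01] at e2 e4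
  rw [h23] at e0 e5
  have t0 := htop 0 (by omega)
  have t2 := htop 2 (by omega)
  have t4 := htop 4 (by omega)
  have a56 := hanti 5 6 le_rfl (by omega)
  have a57 := hanti 5 7 le_rfl (by omega)
  have a58 := hanti 5 8 le_rfl (by omega)
  have h42 : y 4 ≤ y 2 := le_of_mul_le_mul_left (by linarith) hμ0
  have h40 : y 4 < y 0 := by
    by_contra hc
    push Not at hc
    nlinarith [mul_lt_mul_of_pos_right hμ p0]
  -- If the entries at 5 and 6 agree, comparing their equations gives `2 * y 2 = y 4 + y 8`. This
  -- forces the entries at 2, 4 and 5 to be equal, which is incompatible with `μ < 3`.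
  have h56 : 6 < n → y 6 < y 5 := by
    intro h6n
    refine lt_of_le_of_ne a56 fun h => ?_
    have e6 : y 4 + y 7 + y 8 = μ * y 6 := heig 6 h6n
    rw [h] at e6
    have h1 : y 2 = y 5 := by linarith
    have h2 : y 4 = y 5 := by linarith
    rw [h1, h2] at e0
    rw [h2] at h40
    nlinarith [mul_lt_mul_of_pos_right hμ p0]
  have h42' : y 4 < y 2 := by
    refine lt_of_le_of_ne h42 fun h => ?_
    have h65 : y 6 = y 5 := by rw [h] at e4; linarith
    rcases Nat.lt_or_ge 6 n with h6n | h6n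
    · exact (h56 h6n).ne h65
    · rw [hzero 6 h6n] at h65
      linarith
  refine ⟨fun i hi => ?_, fun l hl h6 hln => ?_⟩
  · interval_cases i
    · exact h40
    · rwa [h01]
    · exact h42'
    · rwa [h23]
  · rcases h6.eq_or_lt with rfl | h6
    · exact h56 hln
    obtain ⟨k, rfl⟩ : ∃ k, l = k + 8 := ⟨l - 8, by obtain ⟨r, hr⟩ := hl; omega⟩
    have hk : k % 2 = 0 := by obtain ⟨r, hr⟩ := hl; omega
    -- The vertices `k + 7` and `k + 8` share the neighbours `k + 6` and `k + 9`. If their entries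
    -- agree, so do those at `k + 5` and `k + 10`; by monotonicity all entries in between are equal,
    -- which forces `μ = 3`.
    refine lt_of_le_of_ne (hanti _ _ (by omega) (by omega)) fun h => ?_
    have f1 := heig (k + 1 + 6) (by omega)
    have f2 := heig (k + 2 + 6) (by omega)
    simp only [ladderNbr, Matrix.cons_val] at f1 f2
    rw [if_neg (by omega)] at f1
    rw [if_pos (by omega)] at f2
    norm_num [add_assoc] at f1 f2 h
    have g1 := hanti (k + 5) (k + 6) (by omega) (by omega)
    have g2 := hanti (k + 6) (k + 7) (by omega) (by omega)
    have g3 := hanti (k + 8) (k + 9) (by omega) (by omega)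
    have g4 := hanti (k + 9) (k + 10) (by omega) (by omega)
    have p7 := hpos (k + 7) (by omega)
    rw [h] at f2
    nlinarith [mul_lt_mul_of_pos_right hμ p7]

end Eigenvector

/-! ### Comparison of the largest eigenvalues. -/

section Compare

open Matrix

variable {n : ℕ} {G : SimpleGraph (Fin n)}

/-- A vector on `Fin n`, extended by zero. -/
def extendZero (x : Fin n → ℝ) (i : ℕ) : ℝ := if h : i < n then x ⟨i, h⟩ else 0

lemma extendZero_coe (x : Fin n → ℝ) (i : Fin n) : extendZero x i = x i := by
  simp [extendZero]

lemma extendZero_of_le (x : Fin n → ℝ) {i : ℕ} (h : n ≤ i) : extendZero x i = 0 := by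
  simp [extendZero, h]

lemma matrixGraph_mulVec {a : ℕ → ℕ → ℕ} (hs : ∀ i j, a i j = a j i) (hd : ∀ i, a i i = 0)
    (h1 : ∀ i j, a i j ≤ 1) (z : ℕ → ℝ) (i : Fin n) :
    (realAdj (matrixGraph a n) *ᵥ fun v => z v) i = ∑ j ∈ Finset.range n, (a i j : ℝ) * z j := by
  classical
  rw [Finset.sum_range, mulVec, dotProduct]
  refine Finset.sum_congr rfl fun j _ => ?_
  rw [realAdj_apply]
  have := h1 i j
  simp only [matrixGraph_adj hs hd]
  obtain h | h : a i j = 0 ∨ a i j = 1 := by omega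
  all_goals simp [h]

/-- The largest eigenvalue of a subcubic graph is less than `3`. -/
lemma lt_three_of_eigenvector {s : ℕ → Bool} {a : ℕ → ℕ → ℕ} (h : IsSubcubicMatrix n s a)
    (hn : 1 ≤ n) {x : ℕ → ℝ} {μ : ℝ} (hpos : ∀ i < n, 0 < x i)
    (heig : ∀ i < n, ∑ j ∈ Finset.range n, (a i j : ℝ) * x j = μ * x i) : μ < 3 := by
  have hS : 0 < ∑ i ∈ Finset.range n, x i :=
    Finset.sum_pos (fun i hi => hpos i (Finset.mem_range.1 hi)) ⟨0, Finset.mem_range.2 hn⟩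
  -- Summing the eigenvalue equation over all vertices weights each entry by its degree; some degree
  -- is less than three.
  have h1 : μ * ∑ i ∈ Finset.range n, x i =
      ∑ j ∈ Finset.range n, ((∑ i ∈ Finset.range n, a j i : ℕ) : ℝ) * x j := by
    rw [Finset.mul_sum, ← Finset.sum_congr rfl fun i hi => heig i (Finset.mem_range.1 hi),
      Finset.sum_comm]
    refine Finset.sum_congr rfl fun j _ => ?_
    rw [← Finset.sum_mul]
    push_cast
    simp_rw [h.symm j]
  obtain ⟨k, hk, hk3⟩ : ∃ k ∈ Finset.range n, ∑ i ∈ Finset.range n, a k i ≠ 3 := by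
    by_contra! hc
    refine h.not_closed n hn le_rfl ?_
    rw [blockSum, Finset.sum_congr rfl hc]
    simp [mul_comm]
  have h2 : ∑ j ∈ Finset.range n, ((∑ i ∈ Finset.range n, a j i : ℕ) : ℝ) * x j <
      ∑ j ∈ Finset.range n, 3 * x j := by
    refine Finset.sum_lt_sum (fun j hj => ?_) ⟨k, hk, ?_⟩
    · exact mul_le_mul_of_nonneg_right (by exact_mod_cast h.row_le j n)
        (hpos j (Finset.mem_range.1 hj)).le
    · exact mul_lt_mul_of_pos_right (by exact_mod_cast lt_of_le_of_ne (h.row_le k n) hk3)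
        (hpos k (Finset.mem_range.1 hk))
  rw [← h1, ← Finset.mul_sum] at h2
  exact lt_of_mul_lt_mul_right h2 hS.le

/-- The comparison with the ladder graph, for a graph whose vertices are sorted by a positive
eigenvector. -/
lemma lambdaOne_le_of_antitone (hn : 6 ≤ n) (hG : IsConnectedSubcubicBipartite G) {x : Fin n → ℝ}
    (hx : Antitone x) (hpos : ∀ i, 0 < x i) (heig : realAdj G *ᵥ x = lambdaOne G • x) :
    lambdaOne G ≤ lambdaOne (ladderGraph n) ∧
      (lambdaOne G = lambdaOne (ladderGraph n) → IsB n G) := by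
  obtain ⟨s, hs0, h⟩ := exists_isSubcubicMatrix hG
  set a := natMatrix G
  set X := extendZero x
  have hXpos : ∀ i < n, 0 < X i := fun i hi => by simpa [X, extendZero, hi] using hpos ⟨i, hi⟩
  have hXzero : ∀ i, n ≤ i → X i = 0 := fun i hi => extendZero_of_le x hi
  have hXanti : ∀ i j, i ≤ j → X j ≤ X i := fun i j hij => by
    rcases Nat.lt_or_ge j n with hj | hj
    · simpa [X, extendZero, hj, hij.trans_lt hj] using hx (a := ⟨i, hij.trans_lt hj⟩)
        (b := ⟨j, hj⟩) hij
    · rw [hXzero j hj]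
      rcases Nat.lt_or_ge i n with hi | hi
      · exact (hXpos i hi).le
      · exact (hXzero i hi).ge
  have hXsucc : ∀ l < n, X (l + 1) ≤ X l := fun l _ => hXanti _ _ (by omega)
  have hxX : x = fun v : Fin n => X v := funext fun v => (extendZero_coe x v).symm
  have haX : ∀ i < n, ∑ j ∈ Finset.range n, (a i j : ℝ) * X j = lambdaOne G * X i := by
    intro i hi
    have h1 := congrFun heig ⟨i, hi⟩
    have h2 := matrixGraph_mulVec h.symm h.diag_eq_zero h.le_one X ⟨i, hi⟩
    rw [matrixGraph_natMatrix, ← hxX, h1] at h2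
    rw [← h2, hxX]
    simp
  set τ := placement (s 1) (s 2) (s 3) (s 4)
  have hτ : ∀ i, 5 ≤ i → τ i = i := fun i hi => placement_apply_of_five_le _ _ _ _ hi
  have hle : ∀ k l, k ≤ n → l ≤ n → blockSum a k l ≤ blockSum (ladderPerm τ) k l :=
    fun k l hk hl => h.blockSum_le_ladderPerm hn hs0 hk hl
  -- The vector carried over to the labels of the ladder, so that the form of `ladderPerm τ` at `X`
  -- is the form of the ladder at `Y`.
  set Y : ℕ → ℝ := fun v => X (τ.symm v)
  have hYτ : ∀ i, Y (τ i) = X i := fun i => by simp [Y]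
  set y : Fin n → ℝ := fun v => Y v
  have hrow : ∀ i, ∑ j ∈ Finset.range n, (ladderPerm τ i j : ℝ) * X j =
      ∑ j ∈ Finset.range n, (ladderMatrix (τ i) j : ℝ) * Y j := fun i => by
    rw [← sum_range_comp_perm hτ (by omega : 5 ≤ n)
      fun j => (ladderMatrix (τ i) j : ℝ) * Y j]
    simp only [hYτ]
    rfl
  have hLy : ∀ v : Fin n, (realAdj (ladderGraph n) *ᵥ y) v =
      ∑ j ∈ Finset.range n, (ladderMatrix v j : ℝ) * Y j :=
    matrixGraph_mulVec ladderMatrix_symm ladderMatrix_self ladderMatrix_le_one Y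
  have hyy : y ⬝ᵥ y = ∑ i ∈ Finset.range n, X i * X i := by
    rw [dotProduct, ← Finset.sum_range fun i => Y i * Y i,
      ← sum_range_comp_perm hτ (by omega : 5 ≤ n)]
    simp only [hYτ]
  have hquad : y ⬝ᵥ realAdj (ladderGraph n) *ᵥ y =
      ∑ i ∈ Finset.range n, (∑ j ∈ Finset.range n, (ladderPerm τ i j : ℝ) * X j) * X i := by
    simp only [hrow, dotProduct, hLy]
    rw [← Finset.sum_range fun i => Y i * ∑ j ∈ Finset.range n, (ladderMatrix i j : ℝ) * Y j,
      ← sum_range_comp_perm hτ (by omega : 5 ≤ n)]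
    simp only [hYτ, mul_comm]
  have hmain : lambdaOne G * (y ⬝ᵥ y) ≤ y ⬝ᵥ realAdj (ladderGraph n) *ᵥ y := by
    rw [hquad, hyy, Finset.mul_sum]
    refine le_trans (le_of_eq ?_)
      (quadratic_form_le_of_blockSum_le hXsucc (hXzero n le_rfl) hle)
    refine Finset.sum_congr rfl fun i hi => ?_
    rw [haX i (Finset.mem_range.1 hi), mul_assoc]
  have hyypos : 0 < y ⬝ᵥ y := by
    rw [hyy]
    exact Finset.sum_pos (fun i hi => mul_self_pos.2 (hXpos i (Finset.mem_range.1 hi)).ne')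
      ⟨0, Finset.mem_range.2 (by omega)⟩
  have hLle := quadratic_form_le_lambdaOne (ladderGraph n) y
  refine ⟨le_of_mul_le_mul_right (hmain.trans hLle) hyypos, fun heq => ?_⟩
  have hLeig := mulVec_eq_of_quadratic_form_eq (ladderGraph n)
    (le_antisymm hLle (heq ▸ hmain))
  have hYeig : ∀ v < n, ∑ j ∈ Finset.range n, (ladderMatrix v j : ℝ) * Y j =
      lambdaOne G * Y v := fun v hv => by
    rw [← hLy ⟨v, hv⟩, hLeig, heq]
    rfl
  have hτlt : ∀ i, i < n ↔ τ i < n := fun i => by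
    rcases Nat.lt_or_ge i 5 with hi | hi
    · have := perm_lt hτ hi
      omega
    · rw [hτ i hi]
  have heqrow : ∀ i < n, ∑ j ∈ Finset.range n, (a i j : ℝ) * X j =
      ∑ j ∈ Finset.range n, (ladderPerm τ i j : ℝ) * X j := fun i hi => by
    rw [haX i hi, hrow, hYeig _ ((hτlt i).1 hi), hYτ]
  have hτsymm : ∀ i, 5 ≤ i → τ.symm i = i := fun i hi => by
    rw [Equiv.symm_apply_eq, hτ i hi]
  have hYX : ∀ i, 5 ≤ i → Y i = X i := fun i hi => by simp only [Y, hτsymm i hi]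
  have hYzero : ∀ i, n ≤ i → Y i = 0 := fun i hi => by
    rw [hYX i (by omega), hXzero i hi]
  have hsymmlt : ∀ i < 5, τ.symm i < 5 := fun i hi => perm_lt hτsymm hi
  obtain ⟨h4, hrung⟩ := ladder_eigenvector_strict (y := Y) hn
    (lt_three_of_eigenvector h (by omega) hXpos haX)
    (fun i hi => hXpos _ ((hτlt _).2 (by simpa using hi))) hYzero
    (fun i j hi hij => by
      rw [hYX i hi, hYX j (by omega)]
      exact hXanti i j hij)
    (fun i hi => by
      rw [hYX 5 le_rfl]
      exact hXanti _ _ (hsymmlt i hi).le)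
    (fun i hi => by
      have hext : ∀ v, (if v < n then Y v else 0) = Y v := fun v => by
        split_ifs with hv
        · rfl
        · exact (hYzero v (by omega)).symm
      have := hYeig i hi
      rw [sum_ladderMatrix_mul] at this
      simpa only [hext] using this)
  have hsymm4 : ∀ i < 4, τ.symm i < τ.symm 4 := fun i hi => by
    by_contra hc
    exact absurd (hXanti _ _ (not_lt.1 hc)) (not_le.2 (h4 i hi))
  -- The entry at 4 is strictly smaller than those at 0, 1, 2, 3, so in the decreasing order it
  -- comes last among the first five.
  have hτ4 : τ.symm 4 = 4 := by
    have s0 := hsymm4 0 (by omega)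
    have s1 := hsymm4 1 (by omega)
    have s2 := hsymm4 2 (by omega)
    have s3 := hsymm4 3 (by omega)
    have s4 := hsymmlt 4 (by omega)
    have hne : ∀ i j, i ≠ j → τ.symm i ≠ τ.symm j := fun i j hij h => hij (τ.symm.injective h)
    have n01 := hne 0 1 (by omega)
    have n02 := hne 0 2 (by omega)
    have n03 := hne 0 3 (by omega)
    have n12 := hne 1 2 (by omega)
    have n13 := hne 1 3 (by omega)
    have n23 := hne 2 3 (by omega)
    omega
  have hτ' : ∀ i, 4 ≤ i → τ i = i := fun i hi => by
    rcases hi.eq_or_lt with rfl | hi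
    · exact ((Equiv.symm_apply_eq τ).1 hτ4).symm
    · exact hτ i hi
  rw [← matrixGraph_natMatrix G]
  refine isB_matrixGraph_of_sum_eq h hn hτ' fun l hl hln hel i hi => ?_
  refine sum_row_eq_of_blockSum_eq (fun k hk => ?_) hi
  obtain ⟨l, rfl⟩ : ∃ r, l = r + 1 := ⟨l - 1, by omega⟩
  refine blockSum_eq_of_mulVec_eq hXsucc (hXzero n le_rfl) hle heqrow hk (by omega) ?_
  -- The strict drop after column `l`: at the end of the vector the extension by zero gives it, for
  -- four columns the smallness of the entry at 4, and for larger even numbers of columns the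
  -- passage to a new rung.
  rcases Nat.eq_or_lt_of_le hln with hln' | hln'
  · rw [hXzero (l + 1) hln'.ge]
    exact hXpos l (by omega)
  have hel' : Even (l + 1) := hel.resolve_right hln'.ne
  rcases Nat.lt_or_ge (l + 1) 6 with h6 | h6
  · have hl3 : l = 3 := by obtain ⟨r, hr⟩ := hel'; omega
    subst hl3
    have h3 : τ 3 < 4 := perm_lt hτ' (by omega)
    have := h4 _ h3
    rw [hYτ] at this
    simpa only [Y, hτ4] using this
  · have := hrung (l + 1) hel' h6 hln'
    rw [Nat.add_sub_cancel, hYX _ (by omega), hYX _ (by obtain ⟨r, hr⟩ := hel'; omega)] at this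
    exact this

/-- Every graph on `n` vertices is isomorphic to a graph on `Fin n` whose vertices are sorted by a
given function. -/
lemma exists_antitone_relabelling {V : Type*} [Fintype V] (hV : Fintype.card V = n) (y : V → ℝ) :
    ∃ f : Fin n ≃ V, Antitone (y ∘ f) := by
  obtain ⟨e⟩ : Nonempty (Fin n ≃ V) := ⟨(Fintype.equivFinOfCardEq hV).symm⟩
  refine ⟨(Tuple.sort fun i => - y (e i)).trans e, fun i j hij => ?_⟩
  have := Tuple.monotone_sort (fun i => - y (e i)) hij
  simpa using this

/-- The ladder graph maximizes `lambdaOne` among the connected subcubic bipartite graphs, and the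
maximizers arise from the recursive construction. -/
lemma lambdaOne_le_ladderGraph (hn : 6 ≤ n) {V : Type*} [Fintype V] {G : SimpleGraph V}
    (hV : Fintype.card V = n) (hG : IsConnectedSubcubicBipartite G) :
    lambdaOne G ≤ lambdaOne (ladderGraph n) ∧
      (lambdaOne G = lambdaOne (ladderGraph n) → Nonempty (G ≃g ladderGraph n)) := by
  obtain ⟨y, hy, hyG⟩ := exists_pos_eigenvector hG.connected
  obtain ⟨f, hf⟩ := exists_antitone_relabelling hV y
  let e : G.comap f ≃g G := SimpleGraph.Iso.comap f G
  have heig : realAdj (G.comap f) *ᵥ (y ∘ f) = lambdaOne (G.comap f) • (y ∘ f) := by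
    have := realAdj_mulVec_comp e y
    rw [hyG, ← lambdaOne_congr e] at this
    exact this
  obtain ⟨hle, heq⟩ := lambdaOne_le_of_antitone hn (hG.of_iso e.symm) hf (fun i => hy _) heig
  rw [lambdaOne_congr e] at hle heq
  refine ⟨hle, fun h => ?_⟩
  obtain ⟨e'⟩ := (heq h).nonempty_iso_ladderGraph
  exact ⟨e.symm.trans e'⟩

end Compare

theorem theorem1 (n : ℕ) (hn : 6 ≤ n) :
    (∃ B : SimpleGraph (Fin n), IsB n B) ∧
    ∀ B : SimpleGraph (Fin n), IsB n B →
      IsConnectedSubcubicBipartite B ∧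
      ∀ (V : Type*) [Fintype V] (G : SimpleGraph V),
        Fintype.card V = n → IsConnectedSubcubicBipartite G →
          lambdaOne G ≤ lambdaOne B ∧
          (lambdaOne G = lambdaOne B ↔ Nonempty (G ≃g B)) := by
  refine ⟨exists_isB hn, fun B hB => ?_⟩
  obtain ⟨eB⟩ := hB.nonempty_iso_ladderGraph
  refine ⟨(ladderGraph_isConnectedSubcubicBipartite hn).of_iso eB.symm, fun V _ G hV hG => ?_⟩
  obtain ⟨hle, heq⟩ := lambdaOne_le_ladderGraph hn hV hG
  rw [← lambdaOne_congr eB] at hle heq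
  refine ⟨hle, fun h => ?_, fun ⟨e⟩ => lambdaOne_congr e⟩
  obtain ⟨e⟩ := heq h
  exact ⟨e.trans eB.symm⟩
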